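/- **Proposition.** Let $d\ge 1$ be an integer, let $|n|$ denote the Euclidean norm of $n\in\mathbb Z^d$, and let $\delta_1,\dots,\delta_d$ be the standard unit vectors. For $\psi:\mathbb Z^d\to\mathbb C$ put $(\Delta\psi)_n=\sum_{j=1}^d(\psi_{n+\delta_j}+\psi_{n-\delta_j}-2\psi_n)$, and for $V:\mathbb Z^d\to\mathbb R$ let $H_V=-\Delta+V$ be the discrete Schrödinger operator on $\ell^2(\mathbb Z^d)$, where $V$ acts by multiplication on its maximal domain $\{\psi\in\ell^2(\mathbb Z^d) : V\psi\in\ell^2(\mathbb Z^d)\}$. We say that $H_V$ is *critical at $s$* if $s=\inf\sigma(H_V)$ and the only function $W:\mathbb Z^d\to[0,\infty)$ whose multiplication operator is compact on $\ell^2(\mathbb Z^d)$ and which satisfies $\inf\sigma(H_V-W)=s$ is $W=0$. Let $\gamma>0$, let $a_n=|n|^{-\gamma}$ for $n\ne 0$ and $a_0=1$, and let $V_n=(\Delta a)_n/a_n$ for $n\in\mathbb Z^d$. Then: 1. $\sigma_{\mathrm{ess}}(H_V)=[0,4d]$; 2. $H_V$ is bounded and nonnegative; 3. if $\gamma>(d-1)/2$,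 then $H_V$ is critical at $0$; 4. $0$ is an eigenvalue of $H_V$ (that is, $0\in\sigma_{\mathrm p}(H_V)$) if and only if $\gamma>d/2$. Here the essential spectrum $\sigma_{\mathrm{ess}}$ is the spectrum $\sigma$ without the isolated points of $\sigma$ that are eigenvalues of finite multiplicity. -/

import Mathlib

namespace LatticeSchrodinger

noncomputable section

/-! ### Partially defined operators on a complex inner product space -/

section Operators

variable {E : Type*} [NormedAddCommGroup E] [InnerProductSpace ℂ E]

/-- `T` is a bounded operator defined on the whole space. -/
def IsBoundedOp (T : E →ₗ.[ℂ] E) : Prop :=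
  ∃ S : E →L[ℂ] E, T = (S : E →ₗ[ℂ] E).toPMap ⊤

/-- `T` is a compact operator defined on the whole space. -/
def IsCompactOp (T : E →ₗ.[ℂ] E) : Prop :=
  ∃ S : E →L[ℂ] E, IsCompactOperator S ∧ T = (S : E →ₗ[ℂ] E).toPMap ⊤

/-- `T ≥ 0` in the sense of quadratic forms: `⟨ψ, Tψ⟩` is real and nonnegative on the domain. -/
def IsNonnegOp (T : E →ₗ.[ℂ] E) : Prop :=
  ∀ ψ : T.domain, (inner ℂ (ψ : E) (T ψ)).im = 0 ∧ 0 ≤ (inner ℂ (ψ : E) (T ψ)).re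

/-- The resolvent set: `T - z` maps the domain bijectively onto the space, with a bounded
everywhere defined inverse `R`. -/
def opResolventSet (T : E →ₗ.[ℂ] E) : Set ℂ :=
  {z | ∃ R : E →L[ℂ] E,
    (∀ y : E, ∃ h : R y ∈ T.domain, T ⟨R y, h⟩ - z • R y = y) ∧
    ∀ x : T.domain, R (T x - z • (x : E)) = x}

/-- The spectrum `σ(T)`. -/
def opSpectrum (T : E →ₗ.[ℂ] E) : Set ℂ := (opResolventSet T)ᶜ

/-- The real points of the spectrum (the whole spectrum when `T` is self-adjoint). -/
def opRealSpectrum (T : E →ₗ.[ℂ] E) : Set ℝ := {x | (x : ℂ) ∈ opSpectrum T}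

/-- The kernel of `T - z`. -/
def opEigenspace (T : E →ₗ.[ℂ] E) (z : ℂ) : Submodule ℂ T.domain :=
  LinearMap.ker (T.toFun - z • T.domain.subtype)

/-- The point spectrum `σ_p(T)`, i.e. the set of eigenvalues. -/
def opPointSpectrum (T : E →ₗ.[ℂ] E) : Set ℂ :=
  {z | ∃ ψ : T.domain, (ψ : E) ≠ 0 ∧ T ψ = z • (ψ : E)}

/-- The discrete spectrum: isolated points of the spectrum that are eigenvalues of finite
multiplicity. -/
def opDiscreteSpectrum (T : E →ₗ.[ℂ] E) : Set ℂ :=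
  {z | (∃ ε > 0, opSpectrum T ∩ Metric.ball z ε = {z}) ∧
    z ∈ opPointSpectrum T ∧ FiniteDimensional ℂ (opEigenspace T z)}

/-- The essential spectrum `σ_ess(T)` of a self-adjoint operator. -/
def opEssentialSpectrum (T : E →ₗ.[ℂ] E) : Set ℂ := opSpectrum T \ opDiscreteSpectrum T

end Operators

/-! ### Discrete Schrödinger operators on the lattice -/

/-- The lattice `ℤ^d`. -/
abbrev Lattice (d : ℕ) : Type := Fin d → ℤ

/-- The Hilbert space `ℓ²(ℤ^d)` of complex square-summable functions. -/
abbrev LatticeL2 (d : ℕ) : Type := lp (fun _ : Lattice d => ℂ) 2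

/-- The Euclidean norm on `ℤ^d`. -/
def euclNorm {d : ℕ} (n : Lattice d) : ℝ := Real.sqrt (∑ j, (n j : ℝ) ^ 2)

/-- The unit vector in direction `j`. -/
def unitVec {d : ℕ} (j : Fin d) : Lattice d := Pi.single j 1

/-- The discrete Laplacian `(Δψ)_n = ∑_{|m - n| = 1} (ψ_m - ψ_n)`; the neighbours of `n` are
the points `n ± δ_j`. -/
def latticeLaplacian {d : ℕ} {F : Type*} [AddCommGroup F] (ψ : Lattice d → F) : Lattice d → F :=
  fun n => ∑ j, ((ψ (n + unitVec j) - ψ n) + (ψ (n - unitVec j) - ψ n))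

theorem memlp_translate {d : ℕ} {ψ : Lattice d → ℂ} (h : Memℓp ψ 2) (k : Lattice d) :
    Memℓp (fun n => ψ (n + k)) 2 := by
  have h2 : (0 : ℝ) < (2 : ENNReal).toReal := by norm_num
  rw [memℓp_gen_iff h2] at h ⊢
  exact (Equiv.addRight k).summable_iff.mpr h

theorem memlp_latticeLaplacian {d : ℕ} {ψ : Lattice d → ℂ} (h : Memℓp ψ 2) :
    Memℓp (latticeLaplacian ψ) 2 := by
  have key : ∀ s : Finset (Fin d), Memℓp
      (fun n => ∑ j ∈ s, ((ψ (n + unitVec j) - ψ n) + (ψ (n - unitVec j) - ψ n))) 2 := by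
    intro s
    apply Memℓp.finsetSum
    intro j _
    have h1 := memlp_translate h (unitVec j)
    have h2 := memlp_translate h (-unitVec j)
    simp only [← sub_eq_add_neg] at h2
    exact (h1.sub h).add (h2.sub h)
  exact key Finset.univ

/-- The discrete Laplacian `Δ` as an operator on `ℓ²(ℤ^d)`. -/
def laplacianL2 (d : ℕ) : LatticeL2 d →ₗ[ℂ] LatticeL2 d where
  toFun ψ := ⟨latticeLaplacian (ψ : Lattice d → ℂ), memlp_latticeLaplacian (lp.memℓp ψ)⟩
  map_add' ψ φ := by
    ext n
    simp only [latticeLaplacian, lp.coeFn_add, Pi.add_apply, ← Finset.sum_add_distrib]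
    exact Finset.sum_congr rfl fun j _ => by ring
  map_smul' c ψ := by
    ext n
    simp only [latticeLaplacian, lp.coeFn_smul, Pi.smul_apply, smul_eq_mul, RingHom.id_apply,
      Finset.mul_sum]
    exact Finset.sum_congr rfl fun j _ => by ring

/-- The operator of multiplication by `V` on its maximal domain `{ψ ∈ ℓ² | Vψ ∈ ℓ²}`. -/
def potentialOp {d : ℕ} (V : Lattice d → ℝ) : LatticeL2 d →ₗ.[ℂ] LatticeL2 d where
  domain :=
    { carrier := {ψ | Memℓp (fun n => (V n : ℂ) * ψ n) 2}
      zero_mem' := by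
        have h : (fun n => (V n : ℂ) * (0 : LatticeL2 d) n) = 0 := by ext n; simp
        change Memℓp _ 2
        rw [h]
        exact zero_memℓp
      add_mem' := fun {ψ φ} hψ hφ => by
        have h : (fun n => (V n : ℂ) * (ψ + φ) n) =
            (fun n => (V n : ℂ) * ψ n) + fun n => (V n : ℂ) * φ n := by
          ext n; simp [mul_add]
        change Memℓp _ 2
        rw [h]
        exact Memℓp.add hψ hφ
      smul_mem' := fun c ψ hψ => by
        have h : (fun n => (V n : ℂ) * (c • ψ) n) = c • fun n => (V n : ℂ) * ψ n := by
          ext n; simp [mul_left_comm]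
        change Memℓp _ 2
        rw [h]
        exact Memℓp.const_smul hψ c }
  toFun :=
    { toFun := fun ψ => ⟨fun n => (V n : ℂ) * (ψ : LatticeL2 d) n, ψ.2⟩
      map_add' := fun ψ φ => by ext n; exact mul_add _ _ _
      map_smul' := fun c ψ => by ext n; simp [mul_left_comm] }

/-- The discrete Schrödinger operator `H_V = -Δ + V`, an operator sum with domain `Dom V`. -/
def schrodingerOp {d : ℕ} (V : Lattice d → ℝ) : LatticeL2 d →ₗ.[ℂ] LatticeL2 d :=
  (-laplacianL2 d).toPMap ⊤ + potentialOp V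

/-- `H_V` is critical at `s` (from below): `s = inf σ(H_V)`, and every compact potential `W ≥ 0`
with `inf σ(H_V - W) = s` vanishes. -/
def IsCriticalAt {d : ℕ} (V : Lattice d → ℝ) (s : ℝ) : Prop :=
  IsGLB (opRealSpectrum (schrodingerOp V)) s ∧
    ∀ W : Lattice d → ℝ, (∀ n, 0 ≤ W n) → IsCompactOp (potentialOp W) →
      IsGLB (opRealSpectrum (schrodingerOp V - potentialOp W)) s → W = 0

/-- The sequence `a_n = |n|^{-γ}` for `n ≠ 0`, `a_0 = 1`. -/
def powerSeq (d : ℕ) (γ : ℝ) : Lattice d → ℝ :=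
  fun n => if n = 0 then 1 else euclNorm n ^ (-γ)

/-- The potential `V_n = (Δa)_n / a_n`. -/
def powerPotential (d : ℕ) (γ : ℝ) : Lattice d → ℝ :=
  fun n => latticeLaplacian (powerSeq d γ) n / powerSeq d γ n

end

end LatticeSchrodinger

/-! The positive function `a` satisfies `-Δa + Va = 0` by the choice of `V`. Expanding squares turns
the quadratic form into a sum over edges, `⟨ψ, H_V ψ⟩ = ∑_j ∑_n a_n a_{n+δ_j} |ψ_n/a_n -
ψ_{n+δ_j}/a_{n+δ_j}|²` (`re_inner_schrodinger`), valid for every `ψ` in `ℓ²` because neighbouring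
values of `a` have ratio at most `2 ^ γ`. Nonnegativity is immediate. A zero mode has zero energy on
each edge, so it is a multiple of `a`, and `0` is an eigenvalue exactly when `a` is square summable,
that is, when `2γ > d`.

The neighbour ratios tend to `1`, so `V` is bounded and vanishes at infinity. Damped plane waves
translated to infinity do not feel `V` and put `[0, 4d]` into the spectrum
(`mem_spectrum_of_mem_Icc`). Above `4d`, all but a finite-rank part of `V` is negligible, so the
spectrum there is discrete (`mem_opDiscreteSpectrum_of_lt`).

For criticality, `a` is cut off at a box of half-width `k`. Only the edges crossing the boundary
carry energy: about `k^(d-1)` edges of energy at most `k^(-2γ)`. The total vanishes in the limit if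
`γ > (d-1)/2`, whereas `H_V - W ≥ 0` would bound it below by `W_n a_n²` for every `n` in the box
(`exists_trial_state`, `isCriticalAt_zero`). -/

open Filter Topology

namespace LatticeSchrodinger

/-! ### Spectra and quadratic forms of bounded operators. -/

section AbstractOperators

variable {E : Type*} [NormedAddCommGroup E] [InnerProductSpace ℂ E]

theorem mem_opResolventSet_toPMap (S : E →L[ℂ] E) (z : ℂ) :
    z ∈ opResolventSet ((S : E →ₗ[ℂ] E).toPMap ⊤) ↔ z ∈ resolventSet ℂ S := by
  -- `resolventSet` speaks of `z - S`, whereas `opResolventSet` inverts `S - z`.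
  rw [spectrum.mem_resolventSet_iff, ← IsUnit.neg_iff]
  constructor
  · rintro ⟨R, h1, h2⟩
    refine ⟨⟨-(algebraMap ℂ (E →L[ℂ] E) z - S), R, ?_, ?_⟩, rfl⟩
    · ext y
      obtain ⟨_, hy⟩ := h1 y
      simpa [Algebra.algebraMap_eq_smul_one] using hy
    · ext x
      have := h2 ⟨x, trivial⟩
      simpa [Algebra.algebraMap_eq_smul_one] using this
  · rintro ⟨u, hu⟩
    have hu' : ∀ x, (u : E →L[ℂ] E) x = S x - z • x := fun x => by
      rw [hu]; simp [Algebra.algebraMap_eq_smul_one]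
    refine ⟨(↑u⁻¹ : E →L[ℂ] E), fun y => ⟨trivial, ?_⟩, fun x => ?_⟩
    · have := congrArg (fun T : E →L[ℂ] E => T y) u.mul_inv
      exact (hu' _).symm.trans this
    · have := congrArg (fun T : E →L[ℂ] E => T x) u.inv_mul
      change (↑u⁻¹ : E →L[ℂ] E) (S x - z • (x : E)) = x
      rw [← hu']
      exact this

theorem opSpectrum_toPMap (S : E →L[ℂ] E) :
    opSpectrum ((S : E →ₗ[ℂ] E).toPMap ⊤) = spectrum ℂ S := by
  ext z
  exact not_congr (mem_opResolventSet_toPMap S z)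

theorem mem_opPointSpectrum_toPMap (S : E →L[ℂ] E) (z : ℂ) :
    z ∈ opPointSpectrum ((S : E →ₗ[ℂ] E).toPMap ⊤) ↔ ∃ ψ : E, ψ ≠ 0 ∧ S ψ = z • ψ :=
  ⟨fun ⟨ψ, h⟩ => ⟨ψ, h⟩, fun ⟨ψ, h⟩ => ⟨⟨ψ, trivial⟩, h⟩⟩

/-- A finite-dimensional ambient subspace containing the solutions of `S x = z x` bounds the
eigenspace. -/
theorem finiteDimensional_opEigenspace (S : E →L[ℂ] E) (z : ℂ) (U : Submodule ℂ E)
    [FiniteDimensional ℂ U] (hU : ∀ x, S x = z • x → x ∈ U) :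
    FiniteDimensional ℂ (opEigenspace ((S : E →ₗ[ℂ] E).toPMap ⊤) z) := by
  let f : opEigenspace ((S : E →ₗ[ℂ] E).toPMap ⊤) z →ₗ[ℂ] E :=
    (Submodule.subtype _).comp (Submodule.subtype _)
  have hf : ∀ x, f x ∈ U := fun x => hU _ (sub_eq_zero.mp x.2)
  refine FiniteDimensional.of_injective (f.codRestrict U hf) ?_
  intro x y h
  have h' : f x = f y := congrArg (fun t : U => (t : E)) h
  exact Subtype.ext (Subtype.ext h')

theorem re_inner_smul_self (x : ℝ) (ψ : E) : (inner ℂ ψ ((x : ℂ) • ψ)).re = x * ‖ψ‖ ^ 2 := by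
  rw [inner_smul_right, Complex.re_ofReal_mul]
  exact congrArg (x * ·) (inner_self_eq_norm_sq (𝕜 := ℂ) ψ)

theorem isCompactOperator_of_finiteDimensional_range (F : E →L[ℂ] E)
    [FiniteDimensional ℂ F.range] : IsCompactOperator F := by
  have h1 : IsCompactOperator (F.rangeRestrict) :=
    have : ProperSpace F.range := FiniteDimensional.proper_rclike ℂ F.range
    isCompactOperator_of_locallyCompactSpace_dom _
  exact h1.clm_comp F.range.subtypeL

variable [CompleteSpace E]

theorem real_of_mem_spectrum {S : E →L[ℂ] E} (hS : IsSelfAdjoint S) {z : ℂ}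
    (hz : z ∈ spectrum ℂ S) : z = (z.re : ℂ) := hS.mem_spectrum_eq_re hz

/-- This turns the assumption on `inf σ(H_V - W)` into an inequality between quadratic forms. -/
theorem re_inner_nonneg_of_spectrum {S : E →L[ℂ] E} (hS : IsSelfAdjoint S)
    (h : ∀ x : ℝ, (x : ℂ) ∈ spectrum ℂ S → 0 ≤ x) (ψ : E) : 0 ≤ (inner ℂ ψ (S ψ)).re := by
  have h0 : 0 ≤ S := by
    rw [StarOrderedRing.nonneg_iff_spectrum_nonneg (R := ℝ) S hS]
    intro x hx
    exact h x (by simpa using (spectrum.algebraMap_mem_iff ℂ).mpr hx)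
  exact ((ContinuousLinearMap.nonneg_iff_isPositive S).mp h0).re_inner_nonneg_right ψ

/-- Lax–Milgram: a coercive bounded operator is invertible, with no symmetry required. -/
theorem isUnit_of_forall_le_re_inner {A : E →L[ℂ] E} {c : ℝ} (hc : 0 < c)
    (h : ∀ ψ, c * ‖ψ‖ ^ 2 ≤ (inner ℂ ψ (A ψ)).re) : IsUnit A := by
  refine ContinuousLinearMap.isUnit_of_forall_le_norm_inner_map A (c := ⟨c, hc.le⟩) hc fun x => ?_
  rw [← norm_inner_symm]
  calc ‖x‖ ^ 2 * c = c * ‖x‖ ^ 2 := mul_comm _ _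
    _ ≤ _ := h x
    _ ≤ _ := Complex.re_le_norm _

theorem spectrum_nonneg_of_re_inner {S : E →L[ℂ] E} (h : ∀ ψ, 0 ≤ (inner ℂ ψ (S ψ)).re) {x : ℝ}
    (hx : (x : ℂ) ∈ spectrum ℂ S) : 0 ≤ x := by
  by_contra! hlt
  refine hx ?_
  rw [spectrum.mem_resolventSet_iff, ← IsUnit.neg_iff]
  refine isUnit_of_forall_le_re_inner (c := -x) (by linarith) fun ψ => ?_
  have h1 : (-(algebraMap ℂ (E →L[ℂ] E) (x : ℂ) - S)) ψ = S ψ - (x : ℂ) • ψ := by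
    simp [Algebra.algebraMap_eq_smul_one]
  rw [h1, inner_sub_right, Complex.sub_re, re_inner_smul_self]
  linarith [h ψ]

/-- The span of the eigenvectors of `S` with eigenvalue above `c`. -/
def upperEigenspan (S : E →L[ℂ] E) (c : ℝ) : Submodule ℂ E :=
  ⨆ μ : {x : ℝ // c < x}, Module.End.eigenspace (S : E →ₗ[ℂ] E) ((μ : ℝ) : ℂ)

omit [CompleteSpace E] in
theorem mem_upperEigenspan {S : E →L[ℂ] E} {c μ : ℝ} (hμ : c < μ) {x : E}
    (hx : S x = (μ : ℂ) • x) : x ∈ upperEigenspan S c :=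
  Submodule.mem_iSup_of_mem (⟨μ, hμ⟩ : {x : ℝ // c < x}) (Module.End.mem_eigenspace_iff.mpr hx)

/-- Distinct eigenspaces are orthogonal, so the norm and the form both split over the
eigencomponents of `ψ`. Any nonzero component makes the inequality strict. -/
theorem lt_re_inner_of_mem_upperEigenspan {S : E →L[ℂ] E} (hS : IsSelfAdjoint S) {c : ℝ} {ψ : E}
    (hψ : ψ ∈ upperEigenspan S c) (h0 : ψ ≠ 0) : c * ‖ψ‖ ^ 2 < (inner ℂ ψ (S ψ)).re := by
  classical
  have hsym : (S : E →ₗ[ℂ] E).IsSymmetric :=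
    ContinuousLinearMap.isSelfAdjoint_iff_isSymmetric.mp hS
  have horth := hsym.orthogonalFamily_eigenspaces.comp
    (Complex.ofReal_injective.comp (Subtype.val_injective : Function.Injective
      (Subtype.val : {x : ℝ // c < x} → ℝ)))
  obtain ⟨f, rfl⟩ := (Submodule.mem_iSup_iff_exists_dfinsupp' _ ψ).mp hψ
  rw [DFinsupp.sum] at h0 ⊢
  have e1 : (S (∑ i ∈ f.support, (f i : E))) =
      ∑ i ∈ f.support, ((((i : ℝ) : ℂ) • f i :
        Module.End.eigenspace (S : E →ₗ[ℂ] E) ((i : ℝ) : ℂ)) : E) := by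
    rw [map_sum]
    exact Finset.sum_congr rfl fun i _ => Module.End.mem_eigenspace_iff.mp (f i).2
  have e2 := horth.inner_sum (fun i => f i) (fun i => ((i : ℝ) : ℂ) • f i) f.support
  have e3 := horth.norm_sum (fun i => f i) f.support
  simp only [Function.comp_def] at e2 e3
  rw [e1]
  erw [e2, e3]
  rw [Complex.re_sum, Finset.mul_sum]
  have e4 : ∀ i : {x : ℝ // c < x}, (inner ℂ (f i) (((i : ℝ) : ℂ) • f i)).re = (i : ℝ) * ‖f i‖ ^ 2 := by
    exact fun i => re_inner_smul_self _ (f i)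
  refine Finset.sum_lt_sum (fun i _ => ?_) ?_
  · erw [e4 i]
    exact mul_le_mul_of_nonneg_right i.2.le (by positivity)
  · obtain ⟨i, hi, hne⟩ := Finset.exists_ne_zero_of_sum_ne_zero h0
    refine ⟨i, hi, ?_⟩
    erw [e4 i]
    have : 0 < ‖f i‖ := norm_pos_iff.mpr fun h => hne (by rw [h]; rfl)
    exact mul_lt_mul_of_pos_right i.2 (by positivity)

/-! ### Finite-rank perturbations and discrete spectrum. -/

section FiniteRank

variable {S F : E →L[ℂ] E} {c : ℝ}

/-- `F` is injective on the span: on its kernel the form of `S` is at most `c`, but it exceeds `c`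
on nonzero vectors of the span. -/
theorem finiteDimensional_upperEigenspan (hS : IsSelfAdjoint S) [FiniteDimensional ℂ F.range]
    (h : ∀ ψ, (inner ℂ ψ ((S - F) ψ)).re ≤ c * ‖ψ‖ ^ 2) :
    FiniteDimensional ℂ (upperEigenspan S c) := by
  refine FiniteDimensional.of_injective
    ((F.rangeRestrict : E →ₗ[ℂ] F.range).comp (upperEigenspan S c).subtype) ?_
  rw [← LinearMap.ker_eq_bot, LinearMap.ker_eq_bot']
  intro x hx
  have hFx : F x = 0 := congrArg Subtype.val hx
  by_contra hne
  have h1 := lt_re_inner_of_mem_upperEigenspan hS x.2 (by simpa using hne)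
  have h2 := h x
  rw [sub_apply, hFx, sub_zero] at h2
  linarith

/-- Fredholm alternative. With `A = μ - (S - F)`, invertible by coercivity, `μ - S = A (1 - A⁻¹ F)`
and `A⁻¹ F` is compact. Either `1` is an eigenvalue of `A⁻¹ F`, which yields the eigenvector, or `μ
- S` is invertible. -/
theorem exists_eigenvector_of_mem_spectrum [FiniteDimensional ℂ F.range]
    (h : ∀ ψ, (inner ℂ ψ ((S - F) ψ)).re ≤ c * ‖ψ‖ ^ 2) {μ : ℝ} (hμ : c < μ)
    (hmem : (μ : ℂ) ∈ spectrum ℂ S) : ∃ x, x ≠ 0 ∧ S x = (μ : ℂ) • x := by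
  set A : E →L[ℂ] E := algebraMap ℂ (E →L[ℂ] E) μ - (S - F) with hA
  have hAx : ∀ x, A x = (μ : ℂ) • x - (S x - F x) := fun x => by
    simp [hA, Algebra.algebraMap_eq_smul_one]
  obtain ⟨u, hu⟩ : IsUnit A := by
    refine isUnit_of_forall_le_re_inner (c := μ - c) (by linarith) fun ψ => ?_
    have := h ψ
    rw [sub_apply] at this
    rw [hAx, inner_sub_right, Complex.sub_re, re_inner_smul_self]
    linarith
  have hK : IsCompactOperator ((↑u⁻¹ : E →L[ℂ] E) * F) :=
    (isCompactOperator_of_finiteDimensional_range F).clm_comp _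
  rcases hK.hasEigenvalue_or_mem_resolventSet one_ne_zero with h1 | h1
  · obtain ⟨x, hx, hne⟩ := h1.exists_hasEigenvector
    refine ⟨x, hne, ?_⟩
    have hx' : (↑u⁻¹ : E →L[ℂ] E) (F x) = x := by
      simpa using Module.End.mem_eigenspace_iff.mp hx
    have h2 : (u : E →L[ℂ] E) ((↑u⁻¹ : E →L[ℂ] E) (F x)) = F x :=
      congrArg (fun T : E →L[ℂ] E => T (F x)) u.mul_inv
    rw [hx', hu, hAx] at h2
    have : (μ : ℂ) • x - S x = 0 := by
      have h3 : (μ : ℂ) • x - (S x - F x) - F x = 0 := by rw [h2, sub_self]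
      rw [← h3]; abel
    exact (sub_eq_zero.mp this).symm
  · exfalso
    refine hmem ?_
    rw [spectrum.mem_resolventSet_iff] at h1 ⊢
    have h2 : algebraMap ℂ (E →L[ℂ] E) μ - S =
        u * (algebraMap ℂ (E →L[ℂ] E) 1 - (↑u⁻¹ : E →L[ℂ] E) * F) := by
      rw [mul_sub, ← mul_assoc, Units.mul_inv, one_mul, map_one, mul_one, hu, hA]
      abel
    rw [h2]
    exact u.isUnit.mul h1

omit [CompleteSpace E] in
theorem finite_eigenvalues [FiniteDimensional ℂ (upperEigenspan S c)] :
    {μ : ℝ | c < μ ∧ ∃ x, x ≠ 0 ∧ S x = (μ : ℂ) • x}.Finite := by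
  set s : Set ℝ := {μ : ℝ | c < μ ∧ ∃ x, x ≠ 0 ∧ S x = (μ : ℂ) • x}
  choose v hv using fun μ : s => μ.2.2
  have h1 : LinearIndependent ℂ v := by
    refine Module.End.eigenvectors_linearIndependent' (S : E →ₗ[ℂ] E) (fun μ : s => ((μ : ℝ) : ℂ))
      (Complex.ofReal_injective.comp Subtype.val_injective) v fun μ => ?_
    exact ⟨Module.End.mem_eigenspace_iff.mpr (hv μ).2, (hv μ).1⟩
  let w : s → upperEigenspan S c := fun μ => ⟨v μ, mem_upperEigenspan μ.2.1 (hv μ).2⟩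
  have h2 : LinearIndependent ℂ w := LinearIndependent.of_comp (upperEigenspan S c).subtype h1
  have : Finite s := h2.finite
  exact Set.toFinite s

/-- If `S - F ≤ c` with `F` of finite rank, then the spectrum of `S` above `c` is discrete. -/
theorem mem_opDiscreteSpectrum_of_finiteRank (hS : IsSelfAdjoint S) [FiniteDimensional ℂ F.range]
    (h : ∀ ψ, (inner ℂ ψ ((S - F) ψ)).re ≤ c * ‖ψ‖ ^ 2) {μ : ℝ} (hμ : c < μ)
    (hmem : (μ : ℂ) ∈ spectrum ℂ S) :
    (μ : ℂ) ∈ opDiscreteSpectrum ((S : E →ₗ[ℂ] E).toPMap ⊤) := by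
  have := finiteDimensional_upperEigenspan hS h
  refine ⟨?_, (mem_opPointSpectrum_toPMap S _).mpr (exists_eigenvector_of_mem_spectrum h hμ hmem),
    finiteDimensional_opEigenspace S _ (upperEigenspan S c) fun x hx => mem_upperEigenspan hμ hx⟩
  rw [opSpectrum_toPMap]
  have hfin := (finite_eigenvalues (S := S) (c := c)).subset (Set.sdiff_subset (t := {μ}))
  obtain ⟨ε, hε, hball⟩ := Metric.isOpen_iff.mp hfin.isClosed.isOpen_compl μ (by simp)
  -- Radius `ε` avoids the other eigenvalues above `c`; radius `μ - c` keeps the ball above `c`,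
  -- where every spectral point is an eigenvalue.
  refine ⟨min ε (μ - c), lt_min hε (by linarith), ?_⟩
  ext z
  constructor
  · rintro ⟨hz, hzb⟩
    have hre := real_of_mem_spectrum hS hz
    rw [hre] at hz hzb ⊢
    rw [Metric.mem_ball, Complex.dist_eq, ← Complex.ofReal_sub, Complex.norm_real,
      Real.norm_eq_abs] at hzb
    by_contra hne
    have hc : c < z.re := by
      have := (abs_lt.mp hzb).1
      have := min_le_right ε (μ - c)
      linarith
    refine hball (a := z.re) ?_ ⟨⟨hc, exists_eigenvector_of_mem_spectrum h hc hz⟩, ?_⟩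
    · rw [Metric.mem_ball, Real.dist_eq]
      exact hzb.trans_le (min_le_left _ _)
    · exact fun h' => hne (by simpa using h')
  · rintro rfl
    exact ⟨hmem, Metric.mem_ball_self (lt_min hε (by linarith))⟩

end FiniteRank

end AbstractOperators

/-! ### Translations and the quadratic form of the Laplacian. -/

noncomputable section

variable {d : ℕ}

theorem norm_sq_eq_tsum (ψ : LatticeL2 d) : ‖ψ‖ ^ 2 = ∑' n, ‖ψ n‖ ^ 2 := by
  have := lp.norm_rpow_eq_tsum (p := 2) (by norm_num) ψ
  simpa using this

theorem summable_norm_sq (ψ : LatticeL2 d) : Summable fun n => ‖ψ n‖ ^ 2 := by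
  have := (lp.memℓp ψ).summable (by norm_num)
  simpa using this

theorem memlp_two_iff {ψ : Lattice d → ℂ} : Memℓp ψ 2 ↔ Summable fun n => ‖ψ n‖ ^ 2 := by
  rw [memℓp_gen_iff (by norm_num)]
  simp

/-- Translation on `ℓ²(ℤ^d)`, as an isometry. -/
def translation (k : Lattice d) : LatticeL2 d →ₗᵢ[ℂ] LatticeL2 d where
  toFun ψ := ⟨fun n => ψ (n + k), memlp_translate (lp.memℓp ψ) k⟩
  map_add' _ _ := rfl
  map_smul' _ _ := rfl
  norm_map' ψ := by
    rw [← sq_eq_sq₀ (norm_nonneg _) (norm_nonneg _), norm_sq_eq_tsum, norm_sq_eq_tsum]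
    exact (Equiv.addRight k).tsum_eq (fun n => ‖ψ n‖ ^ 2)

theorem translation_apply (k : Lattice d) (ψ : LatticeL2 d) (n : Lattice d) :
    translation k ψ n = ψ (n + k) := rfl

theorem translation_neg_translation (k : Lattice d) (ψ : LatticeL2 d) :
    translation k (translation (-k) ψ) = ψ := by
  ext n
  simp [translation_apply]

theorem inner_translation_left (k : Lattice d) (ψ φ : LatticeL2 d) :
    inner ℂ (translation k ψ) φ = inner ℂ ψ (translation (-k) φ) := by
  rw [← (translation k).inner_map_map ψ, translation_neg_translation]

theorem re_inner_translation_neg (k : Lattice d) (ψ : LatticeL2 d) :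
    (inner ℂ ψ (translation (-k) ψ)).re = (inner ℂ ψ (translation k ψ)).re := by
  rw [← inner_translation_left, ← inner_conj_symm, Complex.conj_re]

theorem abs_re_inner_translation_le (k : Lattice d) (ψ : LatticeL2 d) :
    |(inner ℂ ψ (translation k ψ)).re| ≤ ‖ψ‖ ^ 2 := by
  calc _ ≤ ‖inner ℂ ψ (translation k ψ)‖ := Complex.abs_re_le_norm _
    _ ≤ ‖ψ‖ * ‖translation k ψ‖ := norm_inner_le_norm _ _
    _ = _ := by rw [LinearIsometry.norm_map, sq]

theorem laplacianL2_eq (ψ : LatticeL2 d) : laplacianL2 d ψ =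
    ∑ j, (translation (unitVec j) ψ + translation (-unitVec j) ψ - (2 : ℂ) • ψ) := by
  ext n
  change latticeLaplacian ψ n = _
  rw [latticeLaplacian, lp.coeFn_sum (E := fun _ : Lattice d => ℂ), Finset.sum_apply]
  refine Finset.sum_congr rfl fun j _ => ?_
  simp only [lp.coeFn_add, lp.coeFn_sub, lp.coeFn_smul, Pi.add_apply, Pi.sub_apply, Pi.smul_apply,
    translation_apply, smul_eq_mul, ← sub_eq_add_neg]
  ring

theorem laplacianL2_isSymmetric : (laplacianL2 d).IsSymmetric := by
  intro ψ φ
  simp only [laplacianL2_eq, sum_inner, inner_sum, inner_sub_left, inner_sub_right, inner_add_left,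
    inner_add_right, inner_translation_left, inner_smul_left, inner_smul_right, neg_neg, map_ofNat]
  exact Finset.sum_congr rfl fun j _ => by ring

theorem re_inner_neg_laplacian (ψ : LatticeL2 d) : (inner ℂ ψ (-laplacianL2 d ψ)).re =
    ∑ j, (2 * ‖ψ‖ ^ 2 - 2 * (inner ℂ ψ (translation (unitVec j) ψ)).re) := by
  have h2 : (2 : ℂ) = ((2 : ℝ) : ℂ) := by norm_num
  simp only [laplacianL2_eq, inner_neg_right, inner_sum, inner_sub_right, inner_add_right,
    Complex.neg_re, Complex.re_sum, Complex.sub_re, Complex.add_re, re_inner_translation_neg, h2,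
    re_inner_smul_self, ← Finset.sum_neg_distrib]
  exact Finset.sum_congr rfl fun j _ => by ring

/-- By Cauchy–Schwarz each direction contributes at most `4 ‖ψ‖²`. -/
theorem re_inner_neg_laplacian_le (ψ : LatticeL2 d) :
    (inner ℂ ψ (-laplacianL2 d ψ)).re ≤ 4 * d * ‖ψ‖ ^ 2 := by
  rw [re_inner_neg_laplacian]
  calc _ ≤ ∑ _j : Fin d, 4 * ‖ψ‖ ^ 2 := Finset.sum_le_sum fun j _ => by
        linarith [neg_le_of_abs_le (abs_re_inner_translation_le (unitVec j) ψ)]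
    _ = _ := by simp; ring

/-! ### Multiplication operators and the bounded operator `-Δ + V`. -/

section Potential

variable {V : Lattice d → ℝ}

theorem domain_potentialOp_of_bounded {C : ℝ} (hV : ∀ n, |V n| ≤ C) :
    (potentialOp V).domain = ⊤ := by
  rw [eq_top_iff]
  intro ψ _
  refine memlp_two_iff.mpr ?_
  refine Summable.of_nonneg_of_le (fun _ => by positivity) (fun n => ?_)
    ((summable_norm_sq ψ).mul_left (C ^ 2))
  rw [norm_mul, mul_pow, Complex.norm_real, Real.norm_eq_abs]
  gcongr
  exact hV n

/-- Multiplication by `V` as a linear map, if it is everywhere defined. -/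
def potentialLin (hV : (potentialOp V).domain = ⊤) : LatticeL2 d →ₗ[ℂ] LatticeL2 d :=
  (potentialOp V).toFun.comp (LinearMap.codRestrict _ LinearMap.id fun ψ => by rw [hV]; trivial)

theorem potentialLin_apply (hV : (potentialOp V).domain = ⊤) (ψ : LatticeL2 d) (n : Lattice d) :
    potentialLin hV ψ n = V n * ψ n := rfl

theorem potentialLin_isSymmetric (hV : (potentialOp V).domain = ⊤) :
    (potentialLin hV).IsSymmetric := by
  intro ψ φ
  rw [lp.inner_eq_tsum, lp.inner_eq_tsum]
  refine tsum_congr fun n => ?_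
  simp [potentialLin_apply]
  ring

theorem re_inner_potentialLin (hV : (potentialOp V).domain = ⊤) (ψ : LatticeL2 d) :
    HasSum (fun n => V n * ‖ψ n‖ ^ 2) (inner ℂ ψ (potentialLin hV ψ)).re := by
  have := Complex.hasSum_re (lp.hasSum_inner ψ (potentialLin hV ψ))
  refine this.congr_fun ?_
  intro n
  exact (re_inner_smul_self (V n) (ψ n)).symm

theorem schrodinger_isSymmetric (hV : (potentialOp V).domain = ⊤) :
    (-laplacianL2 d + potentialLin hV).IsSymmetric :=
  LinearMap.IsSymmetric.add (fun ψ φ => by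
    simp [laplacianL2_isSymmetric ψ φ]) (potentialLin_isSymmetric hV)

/-- The bounded self-adjoint operator `-Δ + V`. -/
def schrodingerCLM (hV : (potentialOp V).domain = ⊤) : LatticeL2 d →L[ℂ] LatticeL2 d :=
  -- Hellinger–Toeplitz: an everywhere defined symmetric operator is automatically bounded.
  ((schrodinger_isSymmetric hV).toSelfAdjoint : LatticeL2 d →L[ℂ] LatticeL2 d)

theorem schrodingerCLM_isSelfAdjoint (hV : (potentialOp V).domain = ⊤) :
    IsSelfAdjoint (schrodingerCLM hV) := (schrodinger_isSymmetric hV).toSelfAdjoint.2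

theorem schrodingerCLM_apply (hV : (potentialOp V).domain = ⊤) (ψ : LatticeL2 d) :
    schrodingerCLM hV ψ = -laplacianL2 d ψ + potentialLin hV ψ := rfl

theorem schrodingerCLM_apply_apply (hV : (potentialOp V).domain = ⊤) (ψ : LatticeL2 d)
    (n : Lattice d) : schrodingerCLM hV ψ n = -latticeLaplacian ψ n + V n * ψ n := rfl

theorem schrodingerOp_eq (hV : (potentialOp V).domain = ⊤) :
    schrodingerOp V = (schrodingerCLM hV : LatticeL2 d →ₗ[ℂ] LatticeL2 d).toPMap ⊤ := by
  refine LinearPMap.ext ?_ ?_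
  · change ⊤ ⊓ (potentialOp V).domain = ⊤
    rw [hV, top_inf_eq]
  · intro ψ h1 h2
    rfl

theorem schrodingerOp_sub_eq {W : Lattice d → ℝ} (hV : (potentialOp V).domain = ⊤)
    (hW : (potentialOp W).domain = ⊤) :
    ∃ S : LatticeL2 d →L[ℂ] LatticeL2 d, IsSelfAdjoint S ∧
      schrodingerOp V - potentialOp W = (S : LatticeL2 d →ₗ[ℂ] LatticeL2 d).toPMap ⊤ ∧
      ∀ ψ, S ψ = schrodingerCLM hV ψ - potentialLin hW ψ := by
  refine ⟨schrodingerCLM hV - (potentialLin_isSymmetric hW).toSelfAdjoint,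
    (schrodingerCLM_isSelfAdjoint hV).sub (potentialLin_isSymmetric hW).toSelfAdjoint.2, ?_,
    fun ψ => rfl⟩
  refine LinearPMap.ext ?_ ?_
  · change (⊤ ⊓ (potentialOp V).domain) ⊓ (potentialOp W).domain = ⊤
    rw [hV, hW, top_inf_eq, top_inf_eq]
  · intro ψ h1 h2
    rfl

end Potential

end

/-! ### The ground state representation and its zero modes. -/

noncomputable section

variable {d : ℕ} {a : Lattice d → ℝ} {C : ℝ}

/-- The energy of the edge from `n` to `n + δ_j` in the ground state representation. -/
def edgeEnergy (a : Lattice d → ℝ) (ψ : Lattice d → ℂ) (j : Fin d) (n : Lattice d) : ℝ :=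
  a n * a (n + unitVec j) * ‖ψ n / a n - ψ (n + unitVec j) / a (n + unitVec j)‖ ^ 2

/-- The weights cancel in the cross term, which is the off-diagonal part of `-Δ`. The ratios survive
only on the diagonal, where they build up `V`. -/
theorem norm_div_sub_div_sq {s t : ℝ} (hs : 0 < s) (ht : 0 < t) (z w : ℂ) :
    s * t * ‖z / s - w / t‖ ^ 2 =
      t / s * ‖z‖ ^ 2 + s / t * ‖w‖ ^ 2 - 2 * (inner ℂ z w).re := by
  rw [RCLike.inner_apply, ← Complex.normSq_eq_norm_sq, ← Complex.normSq_eq_norm_sq,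
    ← Complex.normSq_eq_norm_sq]
  simp only [Complex.normSq_apply, Complex.sub_re, Complex.sub_im, Complex.div_ofReal_re,
    Complex.div_ofReal_im, Complex.mul_re, Complex.conj_re, Complex.conj_im]
  field_simp
  ring

theorem edgeEnergy_eq (ha : ∀ n, 0 < a n) (ψ : Lattice d → ℂ) (j : Fin d) (n : Lattice d) :
    edgeEnergy a ψ j n = a (n + unitVec j) / a n * ‖ψ n‖ ^ 2 +
      a n / a (n + unitVec j) * ‖ψ (n + unitVec j)‖ ^ 2 -
        2 * (inner ℂ (ψ n) (ψ (n + unitVec j))).re :=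
  norm_div_sub_div_sq (ha n) (ha _) _ _

theorem edgeEnergy_nonneg (ha : ∀ n, 0 < a n) (ψ : Lattice d → ℂ) (j : Fin d) (n : Lattice d) :
    0 ≤ edgeEnergy a ψ j n :=
  mul_nonneg (mul_nonneg (ha n).le (ha _).le) (sq_nonneg _)

/-- Neighbouring values of the positive function `a` have bounded ratios. -/
structure BoundedRatios (a : Lattice d → ℝ) (C : ℝ) : Prop where
  pos : ∀ n, 0 < a n
  ratio_add : ∀ n j, a (n + unitVec j) / a n ≤ C
  ratio_sub : ∀ n j, a (n - unitVec j) / a n ≤ C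

namespace BoundedRatios

theorem summable_add (ha : BoundedRatios a C) (ψ : LatticeL2 d) (j : Fin d) :
    Summable fun n => a (n + unitVec j) / a n * ‖ψ n‖ ^ 2 :=
  Summable.of_nonneg_of_le
    (fun _ => mul_nonneg (div_nonneg (ha.pos _).le (ha.pos _).le) (sq_nonneg _))
    (fun _ => mul_le_mul_of_nonneg_right (ha.ratio_add _ j) (sq_nonneg _))
    ((summable_norm_sq ψ).mul_left C)

theorem summable_sub (ha : BoundedRatios a C) (ψ : LatticeL2 d) (j : Fin d) :
    Summable fun n => a (n - unitVec j) / a n * ‖ψ n‖ ^ 2 :=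
  Summable.of_nonneg_of_le
    (fun _ => mul_nonneg (div_nonneg (ha.pos _).le (ha.pos _).le) (sq_nonneg _))
    (fun _ => mul_le_mul_of_nonneg_right (ha.ratio_sub _ j) (sq_nonneg _))
    ((summable_norm_sq ψ).mul_left C)

theorem hasSum_sub_shift (ha : BoundedRatios a C) (ψ : LatticeL2 d) (j : Fin d) :
    HasSum (fun n => a n / a (n + unitVec j) * ‖ψ (n + unitVec j)‖ ^ 2)
      (∑' n, a (n - unitVec j) / a n * ‖ψ n‖ ^ 2) := by
  have := (Equiv.addRight (unitVec j)).hasSum_iff.mpr (ha.summable_sub ψ j).hasSum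
  simpa [Function.comp_def] using this

theorem hasSum_edgeEnergy (ha : BoundedRatios a C) (ψ : LatticeL2 d) (j : Fin d) :
    HasSum (edgeEnergy a ψ j)
      ((∑' n, a (n + unitVec j) / a n * ‖ψ n‖ ^ 2) + (∑' n, a (n - unitVec j) / a n * ‖ψ n‖ ^ 2) -
        2 * (inner ℂ ψ (translation (unitVec j) ψ)).re) := by
  have h := ((ha.summable_add ψ j).hasSum.add (ha.hasSum_sub_shift ψ j)).sub
    ((Complex.hasSum_re (lp.hasSum_inner ψ (translation (unitVec j) ψ))).mul_left 2)
  refine h.congr_fun fun n => ?_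
  exact edgeEnergy_eq ha.pos ψ j n

theorem div_eq (ha : BoundedRatios a C) (n : Lattice d) : latticeLaplacian a n / a n =
    ∑ j, (a (n + unitVec j) / a n + a (n - unitVec j) / a n - 2) := by
  rw [latticeLaplacian, Finset.sum_div]
  refine Finset.sum_congr rfl fun j _ => ?_
  have := (ha.pos n).ne'
  field_simp
  ring

theorem abs_div_le (ha : BoundedRatios a C) (n : Lattice d) :
    |latticeLaplacian a n / a n| ≤ d * (C + C + 2) := by
  rw [ha.div_eq]
  calc _ ≤ ∑ j, |a (n + unitVec j) / a n + a (n - unitVec j) / a n - 2| :=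
        Finset.abs_sum_le_sum_abs _ _
    _ ≤ ∑ _j : Fin d, (C + C + 2) := Finset.sum_le_sum fun j _ => by
        have h1 := ha.ratio_add n j
        have h2 := ha.ratio_sub n j
        have h3 := div_nonneg (ha.pos (n + unitVec j)).le (ha.pos n).le
        have h4 := div_nonneg (ha.pos (n - unitVec j)).le (ha.pos n).le
        rw [abs_le]
        constructor <;> linarith
    _ = _ := by simp; ring

theorem domain_eq (ha : BoundedRatios a C) :
    (potentialOp fun n => latticeLaplacian a n / a n).domain = ⊤ :=
  domain_potentialOp_of_bounded ha.abs_div_le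

/-- The ground state representation of the quadratic form of `-Δ + Δa/a`. -/
theorem re_inner_schrodinger (ha : BoundedRatios a C) (ψ : LatticeL2 d) :
    (inner ℂ ψ (schrodingerCLM ha.domain_eq ψ)).re = ∑ j, ∑' n, edgeEnergy a ψ j n := by
  have h1 : HasSum (fun n => latticeLaplacian a n / a n * ‖ψ n‖ ^ 2)
      (∑ j, ((∑' n, a (n + unitVec j) / a n * ‖ψ n‖ ^ 2) +
        (∑' n, a (n - unitVec j) / a n * ‖ψ n‖ ^ 2) - 2 * ‖ψ‖ ^ 2)) := by
    have h : ∀ j ∈ Finset.univ, HasSum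
        (fun n => (a (n + unitVec j) / a n + a (n - unitVec j) / a n - 2) * ‖ψ n‖ ^ 2)
        ((∑' n, a (n + unitVec j) / a n * ‖ψ n‖ ^ 2) +
        (∑' n, a (n - unitVec j) / a n * ‖ψ n‖ ^ 2) - 2 * ‖ψ‖ ^ 2) := fun j _ => by
      rw [norm_sq_eq_tsum]
      refine (((ha.summable_add ψ j).hasSum.add (ha.summable_sub ψ j).hasSum).sub
        ((summable_norm_sq ψ).hasSum.mul_left 2)).congr_fun fun n => ?_
      ring
    refine (hasSum_sum h).congr_fun fun n => ?_
    rw [ha.div_eq, Finset.sum_mul]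
  rw [schrodingerCLM_apply, inner_add_right, Complex.add_re, re_inner_neg_laplacian,
    (re_inner_potentialLin ha.domain_eq ψ).unique h1, ← Finset.sum_add_distrib]
  refine Finset.sum_congr rfl fun j _ => ?_
  rw [(ha.hasSum_edgeEnergy ψ j).tsum_eq]
  ring

theorem re_inner_schrodinger_nonneg (ha : BoundedRatios a C) (ψ : LatticeL2 d) :
    0 ≤ (inner ℂ ψ (schrodingerCLM ha.domain_eq ψ)).re := by
  rw [ha.re_inner_schrodinger]
  exact Finset.sum_nonneg fun j _ => tsum_nonneg fun n => edgeEnergy_nonneg ha.pos ψ j n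

theorem isBoundedOp (ha : BoundedRatios a C) :
    IsBoundedOp (schrodingerOp fun n => latticeLaplacian a n / a n) :=
  ⟨_, schrodingerOp_eq ha.domain_eq⟩

theorem isNonnegOp (ha : BoundedRatios a C) :
    IsNonnegOp (schrodingerOp fun n => latticeLaplacian a n / a n) := by
  rw [schrodingerOp_eq ha.domain_eq]
  intro ψ
  refine ⟨?_, ha.re_inner_schrodinger_nonneg ψ⟩
  exact ((ContinuousLinearMap.isSelfAdjoint_iff_isSymmetric.mp
    (schrodingerCLM_isSelfAdjoint ha.domain_eq)).im_inner_self_apply (ψ : LatticeL2 d))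

theorem schrodinger_ground_state (ha : BoundedRatios a C) (ψ : LatticeL2 d)
    (hψ : ∀ n, ψ n = a n) : schrodingerCLM ha.domain_eq ψ = 0 := by
  ext n
  rw [schrodingerCLM_apply_apply]
  have h : latticeLaplacian ψ n = ((latticeLaplacian a n : ℝ) : ℂ) := by
    simp [latticeLaplacian, hψ]
  have h0 : (a n : ℂ) ≠ 0 := Complex.ofReal_ne_zero.mpr (ha.pos n).ne'
  rw [h, hψ, Complex.ofReal_div, div_mul_cancel₀ _ h0, neg_add_cancel]
  rfl

/-- The periods of `f` form a subgroup, and the unit vectors generate the lattice. -/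
theorem unitVec_invariant_eq {α : Type*} {f : Lattice d → α} (h : ∀ n j, f (n + unitVec j) = f n)
    (n : Lattice d) : f n = f 0 := by
  let P : AddSubgroup (Lattice d) :=
    { carrier := {k | ∀ n, f (n + k) = f n}
      zero_mem' := fun n => by rw [add_zero]
      add_mem' := fun {k l} hk hl n => by rw [← add_assoc, hl, hk]
      neg_mem' := fun {k} hk n => by rw [← hk (n + -k), neg_add_cancel_right] }
  have hn : n ∈ P := by
    have : n = ∑ j, n j • unitVec j := by
      ext i
      simp [unitVec, Finset.sum_apply, Pi.single_apply]
    rw [this]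
    exact sum_mem fun j _ => zsmul_mem (show unitVec j ∈ P from fun m => h m j) _
  simpa using hn 0

/-- A zero mode is a multiple of the ground state. -/
theorem eq_smul_of_schrodinger_eq_zero (ha : BoundedRatios a C) {ψ : LatticeL2 d}
    (hψ : schrodingerCLM ha.domain_eq ψ = 0) (n : Lattice d) : ψ n / a n = ψ 0 / a 0 := by
  have h := ha.re_inner_schrodinger ψ
  rw [hψ, inner_zero_right, Complex.zero_re] at h
  refine unitVec_invariant_eq (f := fun n => ψ n / a n) (fun n j => ?_) n
  have h1 := (Finset.sum_eq_zero_iff_of_nonneg fun j _ => tsum_nonneg fun n =>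
    edgeEnergy_nonneg ha.pos ψ j n).mp h.symm j (Finset.mem_univ j)
  have h2 := (hasSum_zero_iff_of_nonneg (fun n => edgeEnergy_nonneg ha.pos ψ j n)).mp
    (h1 ▸ (ha.hasSum_edgeEnergy ψ j).summable.hasSum)
  have h3 := congrFun h2 n
  have h4 := mul_pos (ha.pos n) (ha.pos (n + unitVec j))
  have h5 := (mul_eq_zero.mp h3).resolve_left h4.ne'
  exact (sub_eq_zero.mp (norm_eq_zero.mp (pow_eq_zero_iff two_ne_zero |>.mp h5))).symm

theorem zero_mem_pointSpectrum_iff (ha : BoundedRatios a C) :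
    (0 : ℂ) ∈ opPointSpectrum (schrodingerOp fun n => latticeLaplacian a n / a n) ↔
      Summable fun n => a n ^ 2 := by
  rw [schrodingerOp_eq ha.domain_eq, mem_opPointSpectrum_toPMap]
  constructor
  · rintro ⟨ψ, hne, hψ⟩
    rw [zero_smul] at hψ
    set c : ℂ := ψ 0 / a 0
    have h1 : ∀ n, ψ n = c * a n := fun n => by
      have h0 : (a n : ℂ) ≠ 0 := Complex.ofReal_ne_zero.mpr (ha.pos n).ne'
      exact (div_eq_iff h0).mp (ha.eq_smul_of_schrodinger_eq_zero hψ n)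
    have hc : c ≠ 0 := fun hc => hne (by ext n; rw [h1, hc, zero_mul]; rfl)
    have h2 := (summable_norm_sq ψ).mul_left ((‖c‖ ^ 2)⁻¹)
    refine h2.congr fun n => ?_
    have := norm_ne_zero_iff.mpr hc
    rw [h1, norm_mul, mul_pow, Complex.norm_real, Real.norm_eq_abs, sq_abs,
      inv_mul_cancel_left₀ (pow_ne_zero 2 this)]
  · intro hs
    refine ⟨⟨fun n => (a n : ℂ), memlp_two_iff.mpr (by simpa using hs)⟩, fun h => ?_, ?_⟩
    · have := congrArg (fun ψ : LatticeL2 d => ψ 0) h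
      exact (ha.pos 0).ne' (Complex.ofReal_eq_zero.mp this)
    · rw [zero_smul]
      exact ha.schrodinger_ground_state _ fun n => rfl

end BoundedRatios

end

noncomputable section

variable {d : ℕ}

/-! ### Geometry of the lattice -/

theorem euclNorm_eq_norm (n : Lattice d) :
    euclNorm n = ‖(WithLp.toLp 2 fun j => (n j : ℝ) : EuclideanSpace ℝ (Fin d))‖ := by
  simp [euclNorm, EuclideanSpace.norm_eq]

theorem euclNorm_nonneg (n : Lattice d) : 0 ≤ euclNorm n := Real.sqrt_nonneg _

theorem euclNorm_add_le (m n : Lattice d) : euclNorm (m + n) ≤ euclNorm m + euclNorm n := by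
  simp only [euclNorm_eq_norm]
  refine le_trans (le_of_eq ?_) (norm_add_le _ _)
  congr 1
  ext j
  simp

theorem euclNorm_neg (n : Lattice d) : euclNorm (-n) = euclNorm n := by
  simp [euclNorm]

theorem euclNorm_unitVec (j : Fin d) : euclNorm (unitVec j) = 1 := by
  simp [euclNorm, unitVec, Pi.single_apply, ite_pow]

theorem abs_euclNorm_add_unitVec_sub (n : Lattice d) (j : Fin d) :
    |euclNorm (n + unitVec j) - euclNorm n| ≤ 1 := by
  have h1 := euclNorm_add_le n (unitVec j)
  have h2 := euclNorm_add_le (n + unitVec j) (-unitVec j)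
  rw [add_neg_cancel_right, euclNorm_neg] at h2
  rw [euclNorm_unitVec] at h1 h2
  rw [abs_le]
  constructor <;> linarith

theorem abs_euclNorm_sub_unitVec_sub (n : Lattice d) (j : Fin d) :
    |euclNorm (n - unitVec j) - euclNorm n| ≤ 1 := by
  have := abs_euclNorm_add_unitVec_sub (n - unitVec j) j
  rwa [sub_add_cancel, abs_sub_comm] at this

theorem abs_le_euclNorm (n : Lattice d) (j : Fin d) : |(n j : ℝ)| ≤ euclNorm n := by
  rw [euclNorm, ← Real.sqrt_sq_eq_abs]
  exact Real.sqrt_le_sqrt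
    (Finset.single_le_sum (f := fun i => (n i : ℝ) ^ 2) (fun i _ => sq_nonneg _) (Finset.mem_univ j))

theorem norm_le_euclNorm (n : Lattice d) : ‖n‖ ≤ euclNorm n := by
  refine (pi_norm_le_iff_of_nonneg (euclNorm_nonneg n)).mpr fun j => ?_
  rw [Int.norm_eq_abs]
  exact abs_le_euclNorm n j

theorem euclNorm_le_of_forall_abs_le {n : Lattice d} {R : ℝ} (hR : 0 ≤ R)
    (h : ∀ j, |(n j : ℝ)| ≤ R) : euclNorm n ≤ d * R := by
  rw [euclNorm]
  refine Real.sqrt_le_iff.mpr ⟨by positivity, ?_⟩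
  calc ∑ j, (n j : ℝ) ^ 2 ≤ ∑ _j : Fin d, R ^ 2 :=
        Finset.sum_le_sum fun j _ => sq_le_sq' (abs_le.mp (h j)).1 (abs_le.mp (h j)).2
    _ = d * R ^ 2 := by simp
    _ ≤ (d : ℝ) ^ 2 * R ^ 2 := by
        refine mul_le_mul_of_nonneg_right ?_ (sq_nonneg _)
        exact_mod_cast Nat.le_self_pow two_ne_zero d
    _ = _ := by ring

theorem tendsto_norm_cofinite_lattice :
    Tendsto (fun n : Lattice d => ‖n‖) cofinite atTop := by
  rw [← cocompact_eq_cofinite]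
  exact tendsto_norm_cocompact_atTop

theorem tendsto_euclNorm_cofinite : Tendsto (euclNorm (d := d)) cofinite atTop :=
  tendsto_atTop_mono norm_le_euclNorm tendsto_norm_cofinite_lattice

/-- The lattice embeds, preserving the sup norm, into the `ℤ`-span of the standard basis of `ℝ^d`,
where the sum is known to converge. -/
theorem summable_norm_rpow_lattice {r : ℝ} (hr : r < -d) :
    Summable fun n : Lattice d => ‖n‖ ^ r := by
  have h1 : Module.finrank ℤ (Submodule.span ℤ (Set.range (Pi.basisFun ℝ (Fin d)))) = d := by
    rw [ZLattice.rank ℝ]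
    simp
  have h2 := ZLattice.summable_norm_rpow
    (Submodule.span ℤ (Set.range (Pi.basisFun ℝ (Fin d)))) r (by rw [h1]; exact hr)
  let f : Lattice d → Submodule.span ℤ (Set.range (Pi.basisFun ℝ (Fin d))) := fun n =>
    ⟨fun j => (n j : ℝ), by
      have : (fun j => (n j : ℝ)) = ∑ j, n j • Pi.basisFun ℝ (Fin d) j := by
        ext i
        simp [Finset.sum_apply, Pi.single_apply]
      rw [this]
      exact sum_mem fun j _ => Submodule.smul_mem _ _ (Submodule.subset_span ⟨j, rfl⟩)⟩
  have hf : Function.Injective f := fun m n h => by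
    ext j
    have h' : (m j : ℝ) = n j := congrFun (congrArg Subtype.val h) j
    exact_mod_cast h'
  refine (h2.comp_injective hf).congr fun n => ?_
  change ‖fun j => (n j : ℝ)‖ ^ r = ‖n‖ ^ r
  congr 1

theorem summable_of_isBigO_euclNorm {f : Lattice d → ℝ} {r : ℝ} (hr : r < -d)
    (h : f =O[cofinite] fun n => euclNorm n ^ r) : Summable f := by
  refine summable_of_isBigO (summable_norm_rpow_lattice hr) (h.trans ?_)
  refine Asymptotics.IsBigO.of_bound 1 ?_
  filter_upwards [tendsto_norm_cofinite_lattice.eventually_gt_atTop 0] with n hn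
  rw [one_mul, Real.norm_of_nonneg (by have := euclNorm_nonneg n; positivity),
    Real.norm_of_nonneg (by positivity)]
  have : (0 : ℝ) ≤ d := by positivity
  exact Real.rpow_le_rpow_of_nonpos hn (norm_le_euclNorm n) (by linarith)

theorem summable_exp_neg_euclNorm {ε : ℝ} (hε : 0 < ε) :
    Summable fun n : Lattice d => Real.exp (-ε * euclNorm n) := by
  refine summable_of_isBigO_euclNorm (r := -d - 1) (by linarith) ?_
  exact ((isLittleO_exp_neg_mul_rpow_atTop hε _).comp_tendsto tendsto_euclNorm_cofinite).isBigO

/-! ### Singular sequences and the essential spectrum -/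

/-- A plane wave with exponentially decaying amplitude. -/
def dampedWave (θ ε : ℝ) (n : Lattice d) : ℂ :=
  Complex.exp (θ * Complex.I) ^ (∑ j, n j) * (Real.exp (-ε * euclNorm n) : ℝ)

theorem norm_dampedWave (θ ε : ℝ) (n : Lattice d) :
    ‖dampedWave θ ε n‖ = Real.exp (-ε * euclNorm n) := by
  rw [dampedWave, norm_mul, norm_zpow, Complex.norm_exp_ofReal_mul_I, one_zpow, one_mul,
    Complex.norm_real, Real.norm_of_nonneg (Real.exp_pos _).le]

theorem memlp_dampedWave (θ : ℝ) {ε : ℝ} (hε : 0 < ε) :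
    Memℓp (dampedWave (d := d) θ ε) 2 := by
  refine memlp_two_iff.mpr ?_
  refine (summable_exp_neg_euclNorm (d := d) (ε := 2 * ε) (by positivity)).congr fun n => ?_
  rw [norm_dampedWave, ← Real.exp_nat_mul]
  congr 1
  push_cast
  ring

theorem abs_exp_sub_exp_le {ε s t : ℝ} (hε : 0 ≤ ε) (h : |s - t| ≤ 1) :
    |Real.exp (-ε * t) - Real.exp (-ε * s)| ≤ (Real.exp ε - 1) * Real.exp (-ε * t) := by
  obtain ⟨h1, h2⟩ := abs_le.mp h
  have e1 : Real.exp (-ε * s) ≤ Real.exp ε * Real.exp (-ε * t) := by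
    rw [← Real.exp_add]
    exact Real.exp_le_exp.mpr (by nlinarith)
  have e2 : Real.exp (-ε * t) ≤ Real.exp ε * Real.exp (-ε * s) := by
    rw [← Real.exp_add]
    exact Real.exp_le_exp.mpr (by nlinarith)
  have e3 : 1 ≤ Real.exp ε := Real.one_le_exp hε
  have e4 := Real.exp_pos (-ε * t)
  rw [abs_le]
  constructor
  · linarith
  · by_contra! hlt
    nlinarith

/-- The undamped wave has eigenvalue `2d(1 - cos θ)` exactly; using the same frequency in all
coordinates, one parameter sweeps `[0, 4d]`. The error comes from the amplitude, whose relative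
change at each of the `2d` neighbours is at most `exp ε - 1`. -/
theorem norm_laplacian_dampedWave_le (θ : ℝ) {ε : ℝ} (hε : 0 ≤ ε) (n : Lattice d) :
    ‖-latticeLaplacian (dampedWave θ ε) n - (2 * d * (1 - Real.cos θ) : ℝ) * dampedWave θ ε n‖ ≤
      2 * d * (Real.exp ε - 1) * ‖dampedWave θ ε n‖ := by
  set w : ℂ := Complex.exp (θ * Complex.I) with hw
  have hw0 : w ≠ 0 := Complex.exp_ne_zero _
  have hwn : ‖w‖ = 1 := Complex.norm_exp_ofReal_mul_I θ
  set g : Lattice d → ℝ := fun n => Real.exp (-ε * euclNorm n) with hg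
  have hcos : 2 * ((Real.cos θ : ℝ) : ℂ) = w + w⁻¹ := by
    rw [hw, ← Complex.exp_neg, Complex.ofReal_cos, Complex.cos]
    ring_nf
  have hp : ∀ n : Lattice d, dampedWave θ ε n = w ^ (∑ j, n j) * (g n : ℂ) := fun n => rfl
  have hadd : ∀ j : Fin d, ∑ i, (n + unitVec j : Lattice d) i = ∑ i, n i + 1 := fun j => by
    simp [Finset.sum_add_distrib, unitVec]
  have hsub : ∀ j : Fin d, ∑ i, (n - unitVec j : Lattice d) i = ∑ i, n i - 1 := fun j => by
    simp [Finset.sum_sub_distrib, unitVec]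
  have key : -latticeLaplacian (dampedWave θ ε) n -
      (2 * d * (1 - Real.cos θ) : ℝ) * dampedWave θ ε n =
      ∑ j, (w ^ (∑ i, n i) * (w * ((g n - g (n + unitVec j) : ℝ) : ℂ) +
        w⁻¹ * ((g n - g (n - unitVec j) : ℝ) : ℂ))) := by
    have h1 : ((2 * d * (1 - Real.cos θ) : ℝ) : ℂ) * dampedWave θ ε n =
        ∑ _j : Fin d, (2 - (w + w⁻¹)) * dampedWave θ ε n := by
      rw [← hcos]
      simp
      ring
    rw [h1, latticeLaplacian, ← Finset.sum_neg_distrib, ← Finset.sum_sub_distrib]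
    refine Finset.sum_congr rfl fun j _ => ?_
    rw [hp, hp, hp, hadd, hsub, zpow_add_one₀ hw0, zpow_sub_one₀ hw0]
    push_cast
    ring
  rw [key, norm_dampedWave]
  refine (norm_sum_le _ _).trans ?_
  calc _ ≤ ∑ _j : Fin d, 2 * (Real.exp ε - 1) * g n := Finset.sum_le_sum fun j _ => by
        rw [norm_mul, norm_zpow, hwn, one_zpow, one_mul]
        refine (norm_add_le _ _).trans ?_
        rw [norm_mul, norm_mul, norm_inv, hwn, inv_one, one_mul, one_mul, Complex.norm_real,
          Complex.norm_real, Real.norm_eq_abs, Real.norm_eq_abs]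
        have h1 := abs_exp_sub_exp_le hε (abs_euclNorm_add_unitVec_sub n j)
        have h2 := abs_exp_sub_exp_le hε (abs_euclNorm_sub_unitVec_sub n j)
        simp only [hg]
        linarith
    _ = _ := by simp [hg]; ring

theorem norm_le_of_forall_norm_le {ψ φ : LatticeL2 d} {c : ℝ} (hc : 0 ≤ c)
    (h : ∀ n, ‖ψ n‖ ≤ c * ‖φ n‖) : ‖ψ‖ ≤ c * ‖φ‖ := by
  refine (sq_le_sq₀ (norm_nonneg _) (by positivity)).mp ?_
  rw [mul_pow, norm_sq_eq_tsum, norm_sq_eq_tsum, ← tsum_mul_left]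
  refine (summable_norm_sq ψ).tsum_le_tsum (fun n => ?_) ((summable_norm_sq φ).mul_left _)
  rw [← mul_pow]
  exact pow_le_pow_left₀ (norm_nonneg _) (h n) 2

theorem laplacianL2_translation (k : Lattice d) (ψ : LatticeL2 d) :
    laplacianL2 d (translation k ψ) = translation k (laplacianL2 d ψ) := by
  ext n
  change latticeLaplacian (fun n => ψ (n + k)) n = latticeLaplacian ψ (n + k)
  refine Finset.sum_congr rfl fun j _ => ?_
  simp only [add_right_comm, sub_add_eq_add_sub]

/-- Reindexing puts the shift on `V`. Dominated convergence then applies, as `V (m - k)` tends to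
`0` in `k` for each fixed `m`. -/
theorem tendsto_potential_translation {V : Lattice d → ℝ} {C : ℝ} (hC : ∀ n, |V n| ≤ C)
    (hV : (potentialOp V).domain = ⊤) (h0 : Tendsto V cofinite (𝓝 0)) (ψ : LatticeL2 d) :
    Tendsto (fun k => ‖potentialLin hV (translation k ψ)‖) cofinite (𝓝 0) := by
  have h1 : Tendsto (fun k => ‖potentialLin hV (translation k ψ)‖ ^ 2) cofinite (𝓝 0) := by
    have e : ∀ k, ‖potentialLin hV (translation k ψ)‖ ^ 2 = ∑' m, V (m - k) ^ 2 * ‖ψ m‖ ^ 2 := by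
      intro k
      rw [norm_sq_eq_tsum, ← (Equiv.addRight k).tsum_eq fun m => V (m - k) ^ 2 * ‖ψ m‖ ^ 2]
      refine tsum_congr fun n => ?_
      rw [potentialLin_apply, norm_mul, mul_pow, Complex.norm_real, Real.norm_eq_abs, sq_abs,
        translation_apply, Equiv.coe_addRight, add_sub_cancel_right]
    simp only [e]
    rw [← tsum_zero (α := ℝ) (β := Lattice d)]
    refine tendsto_tsum_of_dominated_convergence (bound := fun m => C ^ 2 * ‖ψ m‖ ^ 2)
      ((summable_norm_sq ψ).mul_left _) (fun m => ?_) (Eventually.of_forall fun k m => ?_)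
    · have h2 : Tendsto (fun k => V (m - k)) cofinite (𝓝 0) :=
        h0.comp (sub_right_injective (b := m)).tendsto_cofinite
      simpa using (h2.pow 2).mul_const (‖ψ m‖ ^ 2)
    · rw [Real.norm_of_nonneg (by positivity)]
      refine mul_le_mul_of_nonneg_right ?_ (sq_nonneg _)
      rw [← sq_abs]
      exact pow_le_pow_left₀ (abs_nonneg _) (hC _) 2
  have := h1.sqrt
  simpa using this

section EssentialSpectrum

variable {V : Lattice d → ℝ} {C : ℝ}

/-- A bounded inverse of norm `K` would give `‖φ‖ ≤ K ‖(H_V - x) φ‖`. For translates of a damped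
wave the right side tends to `K η ‖ψ‖`, and slow damping makes `K η < 1`. -/
theorem mem_spectrum_of_mem_Icc (hd : 1 ≤ d) (hC : ∀ n, |V n| ≤ C)
    (hV : (potentialOp V).domain = ⊤) (h0 : Tendsto V cofinite (𝓝 0)) {x : ℝ}
    (hx : x ∈ Set.Icc (0 : ℝ) (4 * d)) : (x : ℂ) ∈ spectrum ℂ (schrodingerCLM hV) := by
  intro hres
  rw [spectrum.mem_resolventSet_iff, ← IsUnit.neg_iff] at hres
  obtain ⟨u, hu⟩ := hres
  have hu' : ∀ ψ, (u : LatticeL2 d →L[ℂ] LatticeL2 d) ψ =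
      (-laplacianL2 d ψ - (x : ℂ) • ψ) + potentialLin hV ψ := fun ψ => by
    rw [hu]
    simp [Algebra.algebraMap_eq_smul_one, schrodingerCLM_apply]
    abel
  set K := ‖(↑u⁻¹ : LatticeL2 d →L[ℂ] LatticeL2 d)‖
  have hK : ∀ ψ, ‖ψ‖ ≤ K * ‖(u : LatticeL2 d →L[ℂ] LatticeL2 d) ψ‖ := fun ψ => by
    have h1 : (↑u⁻¹ : LatticeL2 d →L[ℂ] LatticeL2 d) ((u : LatticeL2 d →L[ℂ] LatticeL2 d) ψ) = ψ :=
      congrArg (fun T : LatticeL2 d →L[ℂ] LatticeL2 d => T ψ) u.inv_mul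
    calc ‖ψ‖ = _ := by rw [h1]
      _ ≤ _ := ContinuousLinearMap.le_opNorm _ _
  have hd0 : (0 : ℝ) < d := by exact_mod_cast hd
  obtain ⟨θ, hθ⟩ : ∃ θ, x = 2 * d * (1 - Real.cos θ) := by
    refine ⟨Real.arccos (1 - x / (2 * d)), ?_⟩
    have h1 : x / (2 * d) ≤ 2 := by
      rw [div_le_iff₀ (by positivity)]
      linarith [hx.2]
    have h2 : 0 ≤ x / (2 * d) := div_nonneg hx.1 (by positivity)
    rw [Real.cos_arccos (by linarith) (by linarith)]
    field_simp
    ring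
  obtain ⟨ε, hε, hKε⟩ : ∃ ε > 0, K * (2 * d * (Real.exp ε - 1)) < 1 := by
    have hcont : Tendsto (fun ε : ℝ => K * (2 * d * (Real.exp ε - 1))) (𝓝[>] 0) (𝓝 0) := by
      have : Continuous fun ε : ℝ => K * (2 * d * (Real.exp ε - 1)) := by fun_prop
      simpa using (this.tendsto 0).mono_left nhdsWithin_le_nhds
    obtain ⟨ε, h1, h2⟩ := ((hcont.eventually_lt_const one_pos).and self_mem_nhdsWithin).exists
    exact ⟨ε, h2, h1⟩
  set η := 2 * d * (Real.exp ε - 1)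
  have hη : 0 ≤ η := by
    have := Real.one_le_exp hε.le
    exact mul_nonneg (by positivity) (by linarith)
  let ψ : LatticeL2 d := ⟨dampedWave θ ε, memlp_dampedWave θ hε⟩
  have hψ : ∀ n, ψ n = dampedWave θ ε n := fun n => rfl
  have hψ0 : 0 < ‖ψ‖ := by
    refine norm_pos_iff.mpr fun h => ?_
    have h1 : ψ 0 = 0 := by rw [h]; rfl
    have h2 := norm_dampedWave (d := d) θ ε 0
    rw [← hψ, h1, norm_zero] at h2
    exact (Real.exp_pos _).ne h2
  have hwave : ‖-laplacianL2 d ψ - (x : ℂ) • ψ‖ ≤ η * ‖ψ‖ := by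
    refine norm_le_of_forall_norm_le hη fun n => ?_
    have := norm_laplacian_dampedWave_le θ hε.le n
    rw [← hθ] at this
    exact this
  have hbound : ∀ k, ‖ψ‖ ≤ K * (η * ‖ψ‖ + ‖potentialLin hV (translation k ψ)‖) := by
    intro k
    have h1 := hK (translation k ψ)
    rw [LinearIsometry.norm_map, hu'] at h1
    refine h1.trans (mul_le_mul_of_nonneg_left ((norm_add_le _ _).trans ?_) (norm_nonneg _))
    refine add_le_add_left ?_ _
    rw [laplacianL2_translation, ← map_neg, ← map_smul, ← map_sub, LinearIsometry.norm_map]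
    exact hwave
  -- This makes the lattice infinite, so that `cofinite` is a proper filter and the bound passes to
  -- the limit.
  have : Nonempty (Fin d) := ⟨⟨0, hd⟩⟩
  have hlim := ((tendsto_potential_translation hC hV h0 ψ).const_add (η * ‖ψ‖)).const_mul K
  have hle := ge_of_tendsto hlim (Eventually.of_forall hbound)
  rw [add_zero, ← mul_assoc] at hle
  nlinarith

/-- Since `V` tends to `0`, its part with values at least `δ` lives on finitely many sites and has
finite rank. Removing it leaves a form bounded by `4d + δ`, the midpoint between `4d` and `x`. -/
theorem mem_opDiscreteSpectrum_of_lt (hV : (potentialOp V).domain = ⊤)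
    (h0 : Tendsto V cofinite (𝓝 0)) {x : ℝ} (hx : 4 * d < x)
    (hmem : (x : ℂ) ∈ spectrum ℂ (schrodingerCLM hV)) :
    (x : ℂ) ∈ opDiscreteSpectrum
      ((schrodingerCLM hV : LatticeL2 d →ₗ[ℂ] LatticeL2 d).toPMap ⊤) := by
  classical
  set δ := (x - 4 * d) / 2 with hδ
  have hδ0 : 0 < δ := by rw [hδ]; linarith
  have hfin : {n | ¬ V n < δ}.Finite := h0.eventually_lt_const hδ0
  set U : Lattice d → ℝ := fun n => if V n < δ then 0 else V n with hU
  have hUdom : (potentialOp U).domain = ⊤ := by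
    obtain ⟨M, hM⟩ := (hfin.image fun n => |V n|).bddAbove
    refine domain_potentialOp_of_bounded (C := max 0 M) fun n => ?_
    by_cases h : V n < δ
    · simp [hU, h]
    · rw [hU]
      simp only [h, if_false]
      exact (hM ⟨n, h, rfl⟩).trans (le_max_right _ _)
  let F : LatticeL2 d →L[ℂ] LatticeL2 d := (potentialLin_isSymmetric hUdom).toSelfAdjoint
  have hFapp : ∀ ψ, F ψ = potentialLin hUdom ψ := fun ψ => rfl
  have hFfin : FiniteDimensional ℂ F.range := by
    have := hfin.to_subtype
    let r : F.range →ₗ[ℂ] ({n | ¬ V n < δ} → ℂ) :=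
      { toFun := fun φ n => (φ : LatticeL2 d) n
        map_add' := fun _ _ => rfl
        map_smul' := fun _ _ => rfl }
    refine FiniteDimensional.of_injective r ?_
    rw [← LinearMap.ker_eq_bot, LinearMap.ker_eq_bot']
    rintro ⟨_, ψ, rfl⟩ h
    refine Subtype.ext ?_
    ext n
    change F ψ n = 0
    by_cases hn : V n < δ
    · rw [hFapp, potentialLin_apply]
      simp [hU, hn]
    · exact congrFun h ⟨n, hn⟩
  refine mem_opDiscreteSpectrum_of_finiteRank (F := F) (c := 4 * d + δ)
    (schrodingerCLM_isSelfAdjoint hV) (fun ψ => ?_) (by rw [hδ]; linarith) hmem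
  have e : (schrodingerCLM hV - F) ψ =
      -laplacianL2 d ψ + (potentialLin hV ψ - potentialLin hUdom ψ) := by
    rw [sub_apply, schrodingerCLM_apply, hFapp]
    abel
  rw [e, inner_add_right, inner_sub_right, Complex.add_re, Complex.sub_re, add_mul]
  refine add_le_add (re_inner_neg_laplacian_le ψ) ?_
  have h1 := (re_inner_potentialLin hV ψ).sub (re_inner_potentialLin hUdom ψ)
  have h2 := (summable_norm_sq ψ).hasSum.mul_left δ
  rw [norm_sq_eq_tsum]
  refine hasSum_le (fun n => ?_) h1 h2
  rw [← sub_mul]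
  refine mul_le_mul_of_nonneg_right ?_ (sq_nonneg _)
  by_cases hn : V n < δ
  · simp [hU, hn, hn.le]
  · simp [hU, hn, hδ0.le]

theorem essentialSpectrum_eq (hd : 1 ≤ d) (hC : ∀ n, |V n| ≤ C)
    (hV : (potentialOp V).domain = ⊤) (h0 : Tendsto V cofinite (𝓝 0))
    (hnn : ∀ ψ, 0 ≤ (inner ℂ ψ (schrodingerCLM hV ψ)).re) :
    opEssentialSpectrum (schrodingerOp V) =
      (fun x : ℝ => (x : ℂ)) '' Set.Icc (0 : ℝ) (4 * (d : ℝ)) := by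
  rw [schrodingerOp_eq hV, opEssentialSpectrum]
  ext z
  constructor
  · rintro ⟨hz, hnd⟩
    rw [opSpectrum_toPMap] at hz
    have hre := real_of_mem_spectrum (schrodingerCLM_isSelfAdjoint hV) hz
    rw [hre] at hz hnd
    refine ⟨z.re, ⟨spectrum_nonneg_of_re_inner hnn hz, ?_⟩, hre.symm⟩
    by_contra! hlt
    exact hnd (mem_opDiscreteSpectrum_of_lt hV h0 hlt hz)
  · rintro ⟨x, hx, rfl⟩
    have hmem : ∀ {y : ℝ}, y ∈ Set.Icc (0 : ℝ) (4 * d) → (y : ℂ) ∈ opSpectrum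
        ((schrodingerCLM hV : LatticeL2 d →ₗ[ℂ] LatticeL2 d).toPMap ⊤) := fun hy => by
      rw [opSpectrum_toPMap]
      exact mem_spectrum_of_mem_Icc hd hC hV h0 hy
    refine ⟨hmem hx, ?_⟩
    rintro ⟨⟨ε, hε, hball⟩, -⟩
    have hd0 : (1 : ℝ) ≤ d := by exact_mod_cast hd
    -- A step of at most half the length of `[0, 4d]`, taken towards the farther endpoint, stays in
    -- the interval; hence no point of it is isolated in the spectrum.
    set t := min (ε / 2) (2 * d) with ht
    have ht0 : 0 < t := lt_min (by positivity) (by positivity)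
    have ht1 : t < ε := (min_le_left _ _).trans_lt (by linarith)
    have ht2 : t ≤ 2 * d := min_le_right _ _
    obtain ⟨y, hy, hyx⟩ : ∃ y ∈ Set.Icc (0 : ℝ) (4 * d), |y - x| = t := by
      rcases le_total x (2 * d) with h | h
      · refine ⟨x + t, ⟨by linarith [hx.1], by linarith⟩, ?_⟩
        rw [add_sub_cancel_left, abs_of_pos ht0]
      · refine ⟨x - t, ⟨by linarith, by linarith [hx.2]⟩, ?_⟩
        rw [sub_sub_cancel_left, abs_neg, abs_of_pos ht0]
    have h1 : (y : ℂ) ∈ ({(x : ℂ)} : Set ℂ) := by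
      rw [← hball]
      refine ⟨hmem hy, ?_⟩
      rw [Metric.mem_ball, Complex.dist_eq, ← Complex.ofReal_sub, Complex.norm_real,
        Real.norm_eq_abs, hyx]
      exact ht1
    have h2 : y = x := by simpa using h1
    rw [h2, sub_self, abs_zero] at hyx
    exact ht0.ne hyx

end EssentialSpectrum

/-- Criticality from trial states with small energy and prescribed value at a point. -/
theorem isCriticalAt_zero {V : Lattice d → ℝ} (hV : (potentialOp V).domain = ⊤)
    (hnn : ∀ ψ, 0 ≤ (inner ℂ ψ (schrodingerCLM hV ψ)).re)
    (hmem : (0 : ℂ) ∈ spectrum ℂ (schrodingerCLM hV)) {a : Lattice d → ℝ} (ha : ∀ n, 0 < a n)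
    (hnull : ∀ n, ∀ ε > 0, ∃ ψ : LatticeL2 d, ψ n = a n ∧
      (inner ℂ ψ (schrodingerCLM hV ψ)).re ≤ ε) : IsCriticalAt V 0 := by
  refine ⟨?_, fun W hW hcpt hglb => ?_⟩
  · rw [schrodingerOp_eq hV]
    constructor
    · intro x hx
      have hx' : (x : ℂ) ∈ spectrum ℂ (schrodingerCLM hV) := by
        rw [← opSpectrum_toPMap]
        exact hx
      exact spectrum_nonneg_of_re_inner hnn hx'
    · intro b hb
      refine hb ?_
      change ((0 : ℝ) : ℂ) ∈ opSpectrum _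
      rw [opSpectrum_toPMap, Complex.ofReal_zero]
      exact hmem
  -- Compactness of `W` enters only through its being everywhere defined.
  · have hWdom : (potentialOp W).domain = ⊤ := by
      obtain ⟨S, -, hS⟩ := hcpt
      rw [hS]
      rfl
    obtain ⟨S, hS, hSeq, hSapp⟩ := schrodingerOp_sub_eq hV hWdom
    have hSnn := re_inner_nonneg_of_spectrum hS fun x hx => hglb.1 (by
      change (x : ℂ) ∈ opSpectrum _
      rw [hSeq, opSpectrum_toPMap]
      exact hx)
    funext n
    have han := ha n
    -- Since `H_V - W ≥ 0`, the energy of a trial state dominates `∑ W |ψ|²`, hence its single term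
    -- `W n * a n ^ 2`.
    have hle : W n * a n ^ 2 ≤ 0 := by
      refine le_of_forall_pos_le_add fun ε hε => ?_
      obtain ⟨ψ, hψ, hE⟩ := hnull n ε hε
      have h1 := hSnn ψ
      rw [hSapp, inner_sub_right, Complex.sub_re] at h1
      have h2 := le_hasSum (re_inner_potentialLin hWdom ψ) n fun m _ =>
        mul_nonneg (hW m) (sq_nonneg _)
      rw [hψ, Complex.norm_real, Real.norm_eq_abs, sq_abs] at h2
      linarith
    have h3 : 0 < a n ^ 2 := by positivity
    exact le_antisymm (by by_contra! h; exact absurd hle (not_le.mpr (mul_pos h h3))) (hW n)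

end

/-! ### The power sequence: bounded ratios and decay of its potential. -/

noncomputable section

variable {d : ℕ}

/-- The Euclidean norm, truncated below at `1`. -/
def truncNorm (n : Lattice d) : ℝ := max 1 (euclNorm n)

theorem one_le_truncNorm (n : Lattice d) : 1 ≤ truncNorm n := le_max_left _ _

theorem truncNorm_pos (n : Lattice d) : 0 < truncNorm n := one_pos.trans_le (one_le_truncNorm n)

theorem one_le_euclNorm {n : Lattice d} (hn : n ≠ 0) : 1 ≤ euclNorm n := by
  obtain ⟨j, hj⟩ := Function.ne_iff.mp hn
  refine le_trans ?_ (abs_le_euclNorm n j)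
  exact_mod_cast Int.one_le_abs hj

/-- Nonzero lattice points have norm at least `1`, so the truncation changes only the origin and
absorbs its special value. -/
theorem powerSeq_eq (γ : ℝ) (n : Lattice d) : powerSeq d γ n = truncNorm n ^ (-γ) := by
  rw [powerSeq, truncNorm]
  split_ifs with h
  · subst h
    simp [euclNorm]
  · rw [max_eq_right (one_le_euclNorm h)]

theorem powerSeq_pos (γ : ℝ) (n : Lattice d) : 0 < powerSeq d γ n := by
  rw [powerSeq_eq]
  exact Real.rpow_pos_of_pos (truncNorm_pos n) _

theorem abs_truncNorm_sub_le {m n : Lattice d} (h : |euclNorm m - euclNorm n| ≤ 1) :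
    |truncNorm m - truncNorm n| ≤ 1 := by
  refine le_trans ?_ h
  rw [truncNorm, truncNorm, max_comm 1, max_comm 1]
  exact abs_max_sub_max_le_abs (euclNorm m) (euclNorm n) 1

theorem powerSeq_div (γ : ℝ) (m n : Lattice d) :
    powerSeq d γ m / powerSeq d γ n = (truncNorm m / truncNorm n) ^ (-γ) := by
  rw [powerSeq_eq, powerSeq_eq, Real.div_rpow (truncNorm_pos m).le (truncNorm_pos n).le]

/-- Truncated norms are at least `1` and differ here by at most `1`, so their ratio is at most `2`.
-/
theorem powerSeq_div_le {γ : ℝ} (hγ : 0 < γ) {m n : Lattice d}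
    (h : |euclNorm m - euclNorm n| ≤ 1) : powerSeq d γ m / powerSeq d γ n ≤ 2 ^ γ := by
  rw [powerSeq_div, Real.rpow_neg (div_pos (truncNorm_pos m) (truncNorm_pos n)).le,
    ← Real.inv_rpow (div_pos (truncNorm_pos m) (truncNorm_pos n)).le, inv_div]
  refine Real.rpow_le_rpow (div_pos (truncNorm_pos n) (truncNorm_pos m)).le ?_ hγ.le
  rw [div_le_iff₀ (truncNorm_pos m)]
  linarith [(abs_le.mp (abs_truncNorm_sub_le h)).1, one_le_truncNorm m]

theorem boundedRatios_powerSeq {γ : ℝ} (hγ : 0 < γ) :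
    BoundedRatios (powerSeq d γ) (2 ^ γ) where
  pos := powerSeq_pos γ
  ratio_add n j := powerSeq_div_le hγ (abs_euclNorm_add_unitVec_sub n j)
  ratio_sub n j := powerSeq_div_le hγ (abs_euclNorm_sub_unitVec_sub n j)

theorem tendsto_truncNorm_cofinite : Tendsto (truncNorm (d := d)) cofinite atTop :=
  tendsto_atTop_mono (fun _ => le_max_right _ _) tendsto_euclNorm_cofinite

theorem tendsto_powerSeq_div (γ : ℝ) {σ : Lattice d → Lattice d}
    (hσ : ∀ n, |euclNorm (σ n) - euclNorm n| ≤ 1) :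
    Tendsto (fun n => powerSeq d γ (σ n) / powerSeq d γ n) cofinite (𝓝 1) := by
  have h1 : Tendsto (fun n => truncNorm (σ n) / truncNorm n - 1) cofinite (𝓝 0) := by
    refine squeeze_zero_norm (fun n => ?_) (tendsto_inv_atTop_zero.comp tendsto_truncNorm_cofinite)
    have h0 := truncNorm_pos n
    rw [Function.comp_apply, div_sub_one h0.ne', Real.norm_eq_abs, abs_div, abs_of_pos h0,
      div_le_iff₀ h0, inv_mul_cancel₀ h0.ne']
    exact abs_truncNorm_sub_le (hσ n)
  have h2 : Tendsto (fun n => truncNorm (σ n) / truncNorm n) cofinite (𝓝 1) := by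
    simpa using h1.add_const 1
  have h3 := h2.rpow_const (p := -γ) (Or.inl one_ne_zero)
  rw [Real.one_rpow] at h3
  simpa only [powerSeq_div] using h3

theorem tendsto_powerPotential {γ : ℝ} (hγ : 0 < γ) :
    Tendsto (powerPotential d γ) cofinite (𝓝 0) := by
  have e : powerPotential d γ = fun n => ∑ j, (powerSeq d γ (n + unitVec j) / powerSeq d γ n +
      powerSeq d γ (n - unitVec j) / powerSeq d γ n - 2) :=
    funext fun n => (boundedRatios_powerSeq hγ).div_eq n
  rw [e, show (0 : ℝ) = ∑ _j : Fin d, (1 + 1 - 2) by norm_num]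
  refine tendsto_finsetSum _ fun j _ => ?_
  exact ((tendsto_powerSeq_div γ fun n => abs_euclNorm_add_unitVec_sub n j).add
    (tendsto_powerSeq_div γ fun n => abs_euclNorm_sub_unitVec_sub n j)).sub_const 2

/-! ### Square summability of the ground state -/

theorem powerSeq_sq (γ : ℝ) (n : Lattice d) :
    powerSeq d γ n ^ 2 = truncNorm n ^ (-(2 * γ)) := by
  rw [powerSeq_eq, ← Real.rpow_natCast, ← Real.rpow_mul (truncNorm_pos n).le]
  congr 1
  push_cast
  ring

theorem summable_powerSeq_sq {γ : ℝ} (hγ : (d : ℝ) / 2 < γ) :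
    Summable fun n => powerSeq d γ n ^ 2 := by
  refine summable_of_isBigO_euclNorm (r := -(2 * γ)) (by linarith) ?_
  refine Filter.EventuallyEq.isBigO ?_
  filter_upwards [tendsto_euclNorm_cofinite.eventually_ge_atTop 1] with n hn
  rw [powerSeq_sq, truncNorm, max_eq_right hn]

/-- The cube `[K, 2K)^d` has `K^d` points, each contributing at least `(2dK)^(-2γ)`. If `2γ ≤ d`,
these sums stay above `(2d)^(-2γ)` however far out the cube lies, against the Cauchy criterion. -/
theorem le_of_summable_powerSeq_sq (hd : 1 ≤ d) {γ : ℝ} (hγ : 0 < γ)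
    (h : Summable fun n => powerSeq d γ n ^ 2) : (d : ℝ) / 2 < γ := by
  by_contra! hle
  have hd0 : (1 : ℝ) ≤ d := by exact_mod_cast hd
  set c : ℝ := (2 * d) ^ (-(2 * γ)) with hc
  have hc0 : 0 < c := by positivity
  obtain ⟨s, hs⟩ := summable_iff_vanishing_norm.mp h c hc0
  let i0 : Fin d := ⟨0, hd⟩
  obtain ⟨M, hM⟩ := (s.image fun n => (n i0).natAbs).bddAbove
  -- This exceeds the size of all first coordinates in `s`, so the cube misses `s`.
  set K : ℕ := M + 1
  have hK : (1 : ℝ) ≤ K := by simp [K]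
  set B : Finset (Lattice d) := Fintype.piFinset fun _ => Finset.Ico (K : ℤ) (2 * K) with hB
  have hdisj : Disjoint B s := by
    rw [Finset.disjoint_left]
    intro n hn hns
    have h1 := (Finset.mem_Ico.mp (Fintype.mem_piFinset.mp hn i0)).1
    have h2 : (n i0).natAbs ≤ M :=
      hM (Finset.mem_coe.mpr (Finset.mem_image.mpr ⟨n, hns, rfl⟩))
    omega
  have hcard : (B.card : ℝ) = (K : ℝ) ^ (d : ℝ) := by
    rw [hB, Fintype.card_piFinset]
    simp only [Int.card_Ico, Finset.prod_const, Finset.card_univ, Fintype.card_fin]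
    rw [show ((2 * K - K : ℤ)).toNat = K by omega, Nat.cast_pow, Real.rpow_natCast]
  have hterm : ∀ n ∈ B, (2 * d * K : ℝ) ^ (-(2 * γ)) ≤ powerSeq d γ n ^ 2 := by
    intro n hn
    rw [powerSeq_sq]
    refine Real.rpow_le_rpow_of_nonpos (truncNorm_pos n) ?_ (by linarith)
    refine max_le (by nlinarith) ?_
    refine (euclNorm_le_of_forall_abs_le (R := 2 * K) (by positivity) fun j => ?_).trans
      (le_of_eq (by ring))
    have h1 := Finset.mem_Ico.mp (Fintype.mem_piFinset.mp hn j)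
    have h2 : |n j| ≤ 2 * K := by rw [abs_le]; omega
    exact_mod_cast h2
  have hsum : c ≤ ∑ n ∈ B, powerSeq d γ n ^ 2 := by
    calc c ≤ c * (K : ℝ) ^ ((d : ℝ) - 2 * γ) :=
          le_mul_of_one_le_right hc0.le (Real.one_le_rpow hK (by linarith))
      _ = B.card • (2 * d * K : ℝ) ^ (-(2 * γ)) := by
          rw [nsmul_eq_mul, hcard, Real.mul_rpow (by positivity) (by positivity), ← hc,
            sub_eq_add_neg, Real.rpow_add (by positivity)]
          ring
      _ ≤ _ := Finset.card_nsmul_le_sum _ _ _ hterm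
  have := hs B hdisj
  rw [Real.norm_eq_abs] at this
  exact absurd (hsum.trans (le_abs_self _)) (not_le.mpr this)

/-! ### Trial states cut off at a box -/

/-- The box of side `2k+1` around the origin. -/
def box (d k : ℕ) : Finset (Lattice d) := Fintype.piFinset fun _ => Finset.Icc (-k : ℤ) k

theorem mem_box {k : ℕ} {n : Lattice d} : n ∈ box d k ↔ ∀ i, -(k : ℤ) ≤ n i ∧ n i ≤ k := by
  simp [box, Fintype.mem_piFinset]

/-- The restriction of a function to a finite set, as an `ℓ²` function. -/
def truncate (a : Lattice d → ℝ) (B : Finset (Lattice d)) : LatticeL2 d :=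
  ⟨fun n => if n ∈ B then (a n : ℂ) else 0, memlp_two_iff.mpr
    (summable_of_ne_finset_zero (s := B) fun n hn => by simp [hn])⟩

theorem truncate_apply (a : Lattice d → ℝ) (B : Finset (Lattice d)) (n : Lattice d) :
    truncate a B n = if n ∈ B then (a n : ℂ) else 0 := rfl

/-- Divided by `a`, the truncation is the indicator of `B`, whose differences vanish except on edges
with exactly one endpoint in `B`. -/
theorem edgeEnergy_truncate {a : Lattice d → ℝ} (ha : ∀ n, 0 < a n) (B : Finset (Lattice d))
    (j : Fin d) (n : Lattice d) : edgeEnergy a (truncate a B) j n =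
      if (n ∈ B ↔ n + unitVec j ∈ B) then 0 else a n * a (n + unitVec j) := by
  have h1 : (a n : ℂ) ≠ 0 := Complex.ofReal_ne_zero.mpr (ha n).ne'
  have h2 : (a (n + unitVec j) : ℂ) ≠ 0 := Complex.ofReal_ne_zero.mpr (ha _).ne'
  rw [edgeEnergy, truncate_apply, truncate_apply]
  by_cases h3 : n ∈ B <;> by_cases h4 : n + unitVec j ∈ B <;> simp [h3, h4, h1, h2]

/-- The lower endpoints of the edges in direction `j` that cross the boundary of the box. -/
def boxBoundary (k : ℕ) (j : Fin d) : Finset (Lattice d) :=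
  Fintype.piFinset (Function.update (fun _ => Finset.Icc (-k : ℤ) k) j {(k : ℤ), -(k : ℤ) - 1})

theorem card_boxBoundary (k : ℕ) (j : Fin d) :
    (boxBoundary k j).card = 2 * (2 * k + 1) ^ (d - 1) := by
  have h1 : (({(k : ℤ), -(k : ℤ) - 1} : Finset ℤ)).card = 2 := Finset.card_pair (by omega)
  rw [boxBoundary, Fintype.card_piFinset, ← Finset.mul_prod_erase _ _ (Finset.mem_univ j),
    Function.update_self, h1]
  congr 1
  rw [Finset.prod_congr rfl (g := fun _ => 2 * k + 1) fun i hi => ?_]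
  · simp
  · rw [Function.update_of_ne (Finset.ne_of_mem_erase hi), Int.card_Icc]
    omega

/-- A crossing edge either leaves through the last layer, `n j = k`, or enters from just before the
first, `n j = -k - 1`. -/
theorem mem_boxBoundary {k : ℕ} {j : Fin d} {n : Lattice d}
    (h : ¬ (n ∈ box d k ↔ n + unitVec j ∈ box d k)) : n ∈ boxBoundary k j := by
  have hj : (n + unitVec j) j = n j + 1 := by simp [unitVec]
  have hi : ∀ i, i ≠ j → (n + unitVec j) i = n i := fun i hi => by simp [unitVec, hi]
  have key : (∀ i, i ≠ j → -(k : ℤ) ≤ n i ∧ n i ≤ k) ∧ (n j = k ∨ n j = -k - 1) := by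
    rw [mem_box, mem_box] at h
    by_cases h1 : ∀ i, -(k : ℤ) ≤ n i ∧ n i ≤ k
    · refine ⟨fun i _ => h1 i, Or.inl ?_⟩
      by_contra hne
      refine h ⟨fun _ i => ?_, fun _ => h1⟩
      by_cases hij : i = j
      · subst hij
        have := h1 i
        omega
      · rw [hi i hij]
        exact h1 i
    · have h2 : ∀ i, -(k : ℤ) ≤ (n + unitVec j) i ∧ (n + unitVec j) i ≤ k := by
        by_contra h2
        exact h ⟨fun h3 => absurd h3 h1, fun h3 => absurd h3 h2⟩
      have h3 : ∀ i, i ≠ j → -(k : ℤ) ≤ n i ∧ n i ≤ k := fun i hij => hi i hij ▸ h2 i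
      refine ⟨h3, Or.inr ?_⟩
      by_contra hne
      refine h1 fun i => ?_
      by_cases hij : i = j
      · subst hij
        have := h2 i
        omega
      · exact h3 i hij
  rw [boxBoundary, Fintype.mem_piFinset]
  intro i
  by_cases hij : i = j
  · subst hij
    simpa using key.2
  · rw [Function.update_of_ne hij, Finset.mem_Icc]
    exact key.1 i hij

theorem powerSeq_le_of_le {γ : ℝ} (hγ : 0 < γ) {k : ℕ} (hk : 1 ≤ k) {n : Lattice d} {j : Fin d}
    (h : (k : ℤ) ≤ |n j|) : powerSeq d γ n ≤ (k : ℝ) ^ (-γ) := by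
  rw [powerSeq_eq]
  have hk0 : (0 : ℝ) < k := by exact_mod_cast hk
  refine Real.rpow_le_rpow_of_nonpos hk0 ?_ (by linarith)
  have h1 : (k : ℝ) ≤ |(n j : ℝ)| := by exact_mod_cast h
  exact h1.trans ((abs_le_euclNorm n j).trans (le_max_right _ _))

theorem tsum_edgeEnergy_truncate_le {γ : ℝ} (hγ : 0 < γ) {k : ℕ} (hk : 1 ≤ k) (j : Fin d) :
    ∑' n, edgeEnergy (powerSeq d γ) (truncate (powerSeq d γ) (box d k)) j n ≤
      2 * 3 ^ (d - 1) * (k : ℝ) ^ ((d : ℝ) - 1 - 2 * γ) := by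
  have hk1 : (1 : ℝ) ≤ k := by exact_mod_cast hk
  have hk0 : (0 : ℝ) < k := by linarith
  have hd : 1 ≤ d := Nat.one_le_iff_ne_zero.mpr fun h => by subst h; exact j.elim0
  rw [tsum_eq_sum (s := boxBoundary k j) fun n hn => ?_]
  · calc _ ≤ (boxBoundary k j).card • ((k : ℝ) ^ (-γ) * (k : ℝ) ^ (-γ)) := by
          refine Finset.sum_le_card_nsmul _ _ _ fun n hn => ?_
          have h0 : 0 ≤ (k : ℝ) ^ (-γ) * (k : ℝ) ^ (-γ) := by positivity
          rw [edgeEnergy_truncate (powerSeq_pos γ)]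
          split_ifs
          · exact h0
          · have hnj := Fintype.mem_piFinset.mp hn j
            rw [Function.update_self, Finset.mem_insert, Finset.mem_singleton] at hnj
            have hj : (n + unitVec j) j = n j + 1 := by simp [unitVec]
            refine mul_le_mul (powerSeq_le_of_le hγ hk (j := j) ?_)
              (powerSeq_le_of_le hγ hk (j := j) ?_) (powerSeq_pos γ _).le (by positivity)
            -- The `j`-th coordinates of the two endpoints are `k, k + 1` or `-k - 1, -k`, all of
            -- absolute value at least `k`.
            · rw [le_abs]; omega
            · rw [hj, le_abs]; omega
      _ = 2 * (2 * k + 1) ^ (d - 1) * (k : ℝ) ^ (-(2 * γ)) := by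
          rw [card_boxBoundary, nsmul_eq_mul, ← Real.rpow_add hk0]
          push_cast
          congr 2
          ring
      _ ≤ 2 * (3 * k) ^ (d - 1) * (k : ℝ) ^ (-(2 * γ)) := by
          gcongr
          linarith
      _ = _ := by
          rw [mul_pow, ← Real.rpow_natCast (k : ℝ), Nat.cast_sub hd, Nat.cast_one,
            sub_eq_add_neg _ (2 * γ), Real.rpow_add hk0]
          ring
  · rw [edgeEnergy_truncate (powerSeq_pos γ), if_pos]
    by_contra h
    exact hn (mem_boxBoundary h)

/-- The boundary energy is of order `k ^ (d - 1 - 2γ)`, and `hγd` makes this exponent negative. -/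
theorem exists_trial_state {γ : ℝ} (hγ : 0 < γ) (hγd : ((d : ℝ) - 1) / 2 < γ) (n : Lattice d)
    {ε : ℝ} (hε : 0 < ε) : ∃ ψ : LatticeL2 d, ψ n = powerSeq d γ n ∧
      (inner ℂ ψ (schrodingerCLM (boundedRatios_powerSeq hγ).domain_eq ψ)).re ≤ ε := by
  have hlim : Tendsto (fun k : ℕ => (d : ℝ) * (2 * 3 ^ (d - 1) *
      (k : ℝ) ^ ((d : ℝ) - 1 - 2 * γ))) atTop (𝓝 0) := by
    have h1 : Tendsto (fun k : ℕ => (k : ℝ) ^ ((d : ℝ) - 1 - 2 * γ)) atTop (𝓝 0) := by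
      have := (tendsto_rpow_neg_atTop (y := 2 * γ - (d - 1)) (by linarith)).comp
        tendsto_natCast_atTop_atTop
      refine this.congr fun k => ?_
      rw [Function.comp_apply]
      congr 1
      ring
    simpa using (h1.const_mul (2 * 3 ^ (d - 1))).const_mul (d : ℝ)
  have hmem : ∀ᶠ k : ℕ in atTop, n ∈ box d k := by
    obtain ⟨M, hM⟩ := (Set.finite_range fun i => (n i).natAbs).bddAbove
    filter_upwards [eventually_ge_atTop M] with k hk
    rw [mem_box]
    intro i
    have : (n i).natAbs ≤ M := hM ⟨i, rfl⟩
    omega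
  obtain ⟨k, h1, h2, h3⟩ :=
    ((hlim.eventually_lt_const hε).and (hmem.and (eventually_ge_atTop 1))).exists
  refine ⟨truncate (powerSeq d γ) (box d k), by rw [truncate_apply, if_pos h2], ?_⟩
  rw [(boundedRatios_powerSeq hγ).re_inner_schrodinger]
  refine le_trans (Finset.sum_le_sum fun j _ => tsum_edgeEnergy_truncate_le hγ h3 j) ?_
  rw [Finset.sum_const, Finset.card_univ, Fintype.card_fin, nsmul_eq_mul]
  exact h1.le

end

end LatticeSchrodinger

/-! ### Assembly of the four claims. -/

theorem proposition3p7 (d : ℕ) (hd : 1 ≤ d) (γ : ℝ) (hγ : 0 < γ) :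
    LatticeSchrodinger.opEssentialSpectrum
        (LatticeSchrodinger.schrodingerOp (LatticeSchrodinger.powerPotential d γ)) =
      (fun x : ℝ => (x : ℂ)) '' Set.Icc (0 : ℝ) (4 * (d : ℝ)) ∧
    (LatticeSchrodinger.IsBoundedOp
        (LatticeSchrodinger.schrodingerOp (LatticeSchrodinger.powerPotential d γ)) ∧
      LatticeSchrodinger.IsNonnegOp
        (LatticeSchrodinger.schrodingerOp (LatticeSchrodinger.powerPotential d γ))) ∧
    (((d : ℝ) - 1) / 2 < γ →
      LatticeSchrodinger.IsCriticalAt (LatticeSchrodinger.powerPotential d γ) 0) ∧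
    ((0 : ℂ) ∈ LatticeSchrodinger.opPointSpectrum
        (LatticeSchrodinger.schrodingerOp (LatticeSchrodinger.powerPotential d γ)) ↔
      (d : ℝ) / 2 < γ) := by
  have ha := LatticeSchrodinger.boundedRatios_powerSeq (d := d) hγ
  have hess := LatticeSchrodinger.essentialSpectrum_eq hd ha.abs_div_le ha.domain_eq
    (LatticeSchrodinger.tendsto_powerPotential hγ)
    ha.re_inner_schrodinger_nonneg
  refine ⟨hess, ⟨ha.isBoundedOp, ha.isNonnegOp⟩, fun hγd => ?_, ?_⟩
  · refine LatticeSchrodinger.isCriticalAt_zero ha.domain_eq ha.re_inner_schrodinger_nonneg ?_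
      (LatticeSchrodinger.powerSeq_pos γ)
      fun n ε hε => LatticeSchrodinger.exists_trial_state hγ hγd n hε
    -- `0` is a spectral point as an endpoint of `[0, 4d]`, whether or not it is an eigenvalue.
    rw [← Complex.ofReal_zero]
    exact LatticeSchrodinger.mem_spectrum_of_mem_Icc hd ha.abs_div_le ha.domain_eq
      (LatticeSchrodinger.tendsto_powerPotential hγ)
      ⟨le_rfl, by positivity⟩
  · exact ha.zero_mem_pointSpectrum_iff.trans
      ⟨LatticeSchrodinger.le_of_summable_powerSeq_sq hd hγ, LatticeSchrodinger.summable_powerSeq_sq⟩
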